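/- Let $d\ge 1$. For a finite nonempty set $A\subseteq\mathbb{R}^d$ put $\delta_A=\frac{1}{\#A}\sum_{a\in A}\delta_a$, where $\delta_a$ is the Dirac measure at $a$. A pair $(R,B)$, where $R$ is a $d\times d$ integer matrix all of whose (complex) eigenvalues have modulus $>1$ and $B\subseteq\mathbb{Z}^d$ is finite, is called admissible if there is a finite set $L\subseteq\mathbb{Z}^d$ with $\#L=\#B$ such that the matrix $\big[\tfrac{1}{\sqrt{\#B}}\,e^{-2\pi i (R^{-1}b)\cdot \ell}\big]_{b\in B,\ \ell\in L}$ is unitary. Let $\mathcal{D}_d$ be the set of all pairs $(R,B)$ with $R=\mathrm{diag}(m_1,\dots,m_d)$, where $m_1,\dots,m_d\ge 2$ are integers, and $B$ a nonempty subset of $\{0,1,\dots,m_1-1\}\times\cdots\times\{0,1,\dots,m_d-1\}$. Theorem. Let $\{(R_n,B_n)\}_{n=1}^\infty\subseteq\mathcal{D}_d$ be a sequence of admissible pairs. Suppose that there is an admissible pair $(R,B)$ such that $(R_n,B_n)=(R,B)$ for infinitely many $n$ and all diagonal entries of $R$ are at least $d+1$. Then the measures $$\mu_n=\delta_{R_1^{-1}B_1}*\delta_{(R_2R_1)^{-1}B_2}*\cdots*\delta_{(R_n\cdots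 R_2R_1)^{-1}B_n}$$ converge weakly to a Borel probability measure $\mu$ on $\mathbb{R}^d$ (the infinite convolution of the sequence), and $\mu$ is a spectral measure with a spectrum in $\mathbb{Z}^d$: there is a (countable) set $\Lambda\subseteq\mathbb{Z}^d$ such that the exponentials $e_\lambda(x)=e^{2\pi i\lambda\cdot x}$, $\lambda\in\Lambda$, form an orthonormal basis of $L^2(\mu)$. -/

import Mathlib

open MeasureTheory Filter Topology
open scoped ENNReal BoundedContinuousFunction

noncomputable section

namespace InfConv

/-- The integer vector `k ∈ ℤ^d`, regarded as a point of Euclidean space `ℝ^d`. -/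
def intVec {d : ℕ} (k : Fin d → ℤ) : EuclideanSpace ℝ (Fin d) :=
  WithLp.toLp 2 (fun i => (k i : ℝ))

/-- The integer lattice `ℤ^d ⊆ ℝ^d`. -/
def intLattice (d : ℕ) : Set (EuclideanSpace ℝ (Fin d)) :=
  Set.range intVec

/-- The point `M⁻¹ b ∈ ℝ^d`, for an integer matrix `M` (inverted over `ℝ`) and `b ∈ ℤ^d`. -/
def invApply {d : ℕ} (M : Matrix (Fin d) (Fin d) ℤ) (b : Fin d → ℤ) :
    EuclideanSpace ℝ (Fin d) :=
  WithLp.toLp 2 (Matrix.mulVec (M.map (Int.cast : ℤ → ℝ))⁻¹ (fun i => (b i : ℝ)))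

open Classical in
/-- The finite set `M⁻¹ B ⊆ ℝ^d`. -/
def invImage {d : ℕ} (M : Matrix (Fin d) (Fin d) ℤ) (B : Finset (Fin d → ℤ)) :
    Finset (EuclideanSpace ℝ (Fin d)) :=
  B.image (invApply M)

/-- The uniform discrete measure `δ_A = (1 / #A) ∑_{a ∈ A} δ_a`. -/
def discreteMeasure {d : ℕ} (A : Finset (EuclideanSpace ℝ (Fin d))) :
    Measure (EuclideanSpace ℝ (Fin d)) :=
  (A.card : ℝ≥0∞)⁻¹ • ∑ a ∈ A, Measure.dirac a

/-- All complex eigenvalues of the integer matrix `R` have modulus strictly greater than `1`. -/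
def IsExpanding {d : ℕ} (R : Matrix (Fin d) (Fin d) ℤ) : Prop :=
  ∀ z : ℂ, Module.End.HasEigenvalue (Matrix.toLin' (R.map (Int.cast : ℤ → ℂ))) z → 1 < ‖z‖

/-- The matrix `[ (#B)^{-1/2} e^{-2πi (R⁻¹ b) ⬝ ℓ} ]` with rows `b ∈ B` and columns `ℓ ∈ L`. -/
def hadamardMatrix {d : ℕ} (R : Matrix (Fin d) (Fin d) ℤ) (B L : Finset (Fin d → ℤ)) :
    Matrix B L ℂ :=
  Matrix.of fun b l =>
    ((1 / Real.sqrt (B.card : ℝ) : ℝ) : ℂ) *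
      Complex.exp (-2 * Real.pi * Complex.I *
        ((inner ℝ (invApply R b.1) (intVec l.1) : ℝ) : ℂ))

/-- `(R, B)` is an admissible pair: `R` is expanding and there is a finite `L ⊆ ℤ^d` with
`#L = #B` for which the matrix `hadamardMatrix R B L` is unitary. -/
def IsAdmissiblePair {d : ℕ} (R : Matrix (Fin d) (Fin d) ℤ) (B : Finset (Fin d → ℤ)) : Prop :=
  IsExpanding R ∧
    ∃ L : Finset (Fin d → ℤ), L.card = B.card ∧
      hadamardMatrix R B L * (hadamardMatrix R B L).conjTranspose = 1 ∧
      (hadamardMatrix R B L).conjTranspose * hadamardMatrix R B L = 1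

/-- The class `𝒟_d` of pairs `(R, B)` with `R = diag(m_1, …, m_d)`, all `m_i ≥ 2` integers, and
`B` a nonempty subset of `{0, …, m_1 - 1} × ⋯ × {0, …, m_d - 1}`. -/
def diagonalPairs (d : ℕ) : Set (Matrix (Fin d) (Fin d) ℤ × Finset (Fin d → ℤ)) :=
  {p | p.1.IsDiag ∧ (∀ i, 2 ≤ p.1 i i) ∧ p.2.Nonempty ∧
    ∀ b ∈ p.2, ∀ i, 0 ≤ b i ∧ b i ≤ p.1 i i - 1}

/-- The product of the first `n` matrices, the later ones on the left. Sequences are indexed from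
`0`, so that this is `R_n ⋯ R_2 R_1` in the usual numbering `R_{k+1} = R k`. -/
def matProd {d : ℕ} (R : ℕ → Matrix (Fin d) (Fin d) ℤ) : ℕ → Matrix (Fin d) (Fin d) ℤ
  | 0 => 1
  | n + 1 => R n * matProd R n

/-- The finite convolution
`μ_n = δ_{R_1⁻¹ B_1} ∗ δ_{(R_2 R_1)⁻¹ B_2} ∗ ⋯ ∗ δ_{(R_n ⋯ R_1)⁻¹ B_n}`
(and `μ_0 = δ_0`, the neutral element of convolution). -/
def finiteConvolution {d : ℕ} (R : ℕ → Matrix (Fin d) (Fin d) ℤ)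
    (B : ℕ → Finset (Fin d → ℤ)) : ℕ → Measure (EuclideanSpace ℝ (Fin d))
  | 0 => Measure.dirac 0
  | n + 1 =>
      Measure.conv (finiteConvolution R B n)
        (discreteMeasure (invImage (matProd R (n + 1)) (B n)))

/-- The Borel probability measure `μ` is the infinite convolution of the sequence `(R_n, B_n)`,
i.e. the weak limit of the finite convolutions `μ_n`. -/
def IsInfiniteConvolution {d : ℕ} (R : ℕ → Matrix (Fin d) (Fin d) ℤ)
    (B : ℕ → Finset (Fin d → ℤ)) (μ : Measure (EuclideanSpace ℝ (Fin d))) : Prop :=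
  IsProbabilityMeasure μ ∧
    ∀ f : EuclideanSpace ℝ (Fin d) →ᵇ ℝ,
      Tendsto (fun n => ∫ x, f x ∂(finiteConvolution R B n)) atTop (𝓝 (∫ x, f x ∂μ))

/-- The exponential function `e_ξ(x) = e^{2πi ξ ⬝ x}`. -/
def expFun {d : ℕ} (ξ x : EuclideanSpace ℝ (Fin d)) : ℂ :=
  Complex.exp (2 * Real.pi * Complex.I * ((inner ℝ ξ x : ℝ) : ℂ))

/-- The countable set `Λ ⊆ ℝ^d` is a spectrum of `μ`: the exponentials `e_ξ`, `ξ ∈ Λ`, form an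
orthonormal (Hilbert) basis of `L²(μ)`. -/
def IsSpectrum {d : ℕ} (μ : Measure (EuclideanSpace ℝ (Fin d)))
    (Λ : Set (EuclideanSpace ℝ (Fin d))) : Prop :=
  Λ.Countable ∧
    ∃ e : HilbertBasis Λ ℂ (Lp ℂ 2 μ), ∀ ξ : Λ, (e ξ : EuclideanSpace ℝ (Fin d) → ℂ) =ᵐ[μ] expFun ξ.1

end InfConv

end

noncomputable section

namespace InfConv

/-! Write P_n for the product of the first n dilations. The Fourier transform of μ factors as a
trigonometric product `maskProd` over the first n levels times the transform of a tail measure ν_n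
at P_n⁻¹ξ. Unitarity makes each level a tile: the squared moduli of its mask, translated by a finite
set of integer vectors, sum to 1. Tiles of successive levels combine into nested finite sets of
frequencies for the partial products (`IsTile.exists_succ`).

Orthogonality survives the limit, but completeness can fail if mass escapes to infinity. The partial
products are P_nℤ^d-periodic, so a new frequency may be moved inside its coset of P_nℤ^d; it is
moved to where the transform of ν_n is bounded below. Then dominated convergence turns the finite
tile identities into Parseval's identity for every exponential (`exists_orthogonal_hasSum`), and
this suffices for a spectrum (`isSpectrum_of_hasSum`).

The lower bound is needed only for infinitely many n, namely those at which the repeated pair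
occurs. There ν_n is one level of that pair followed by some measure ν on the unit cube. Such ν form
a compact set, so a uniform bound follows once the transform of the resulting measure vanishes on no
coset of ℤ^d (`exists_le_norm_mask_mul_ft`). If it vanished on ξ + ℤ^d, the image on the torus of
the measure weighted by e_ξ would be zero, and every support point would have another integer
translate in the support (`exists_translate_mem_of_ft_eq_zero`). Inside the cube this forces digits
to jump between 0 and r_i - 1 while otherwise drifting by at most one. With only d coordinates and
every r_i ≥ d + 1, a pigeonhole argument excludes it (`false_of_counters`, `exists_no_translate`).
-/

variable {d : ℕ}

/-! ### Exponentials, Fourier transforms and masks. -/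

/-- Coordinatewise multiplication by the vector `a`. -/
def scale (a : Fin d → ℝ) (x : EuclideanSpace ℝ (Fin d)) : EuclideanSpace ℝ (Fin d) :=
  WithLp.toLp 2 fun i => a i * x i

/-- The Fourier transform `ξ ↦ ∫ e^{2πi ξ ⬝ x} dμ(x)`. -/
def ft (μ : Measure (EuclideanSpace ℝ (Fin d))) (ξ : EuclideanSpace ℝ (Fin d)) : ℂ :=
  ∫ x, expFun ξ x ∂μ

/-- The normalized exponential sum of a finite set of integer vectors. -/
def mask (B : Finset (Fin d → ℤ)) (ξ : EuclideanSpace ℝ (Fin d)) : ℂ :=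
  (B.card : ℂ)⁻¹ * ∑ b ∈ B, expFun ξ (intVec b)

/-- The unit cube `[0, 1]^d`. -/
def cube (d : ℕ) : Set (EuclideanSpace ℝ (Fin d)) := {x | ∀ i, x i ∈ Set.Icc (0 : ℝ) 1}

@[simp] lemma scale_apply (a : Fin d → ℝ) (x : EuclideanSpace ℝ (Fin d)) (i : Fin d) :
    scale a x i = a i * x i := rfl

@[simp] lemma intVec_apply (k : Fin d → ℤ) (i : Fin d) : intVec k i = (k i : ℝ) := rfl

lemma intVec_injective : Function.Injective (intVec (d := d)) := by
  intro k l h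
  funext i
  have := congrArg (fun x : EuclideanSpace ℝ (Fin d) => x i) h
  simpa using this

@[simp] lemma intVec_zero : intVec (0 : Fin d → ℤ) = 0 := by ext i; simp

lemma intVec_add (k l : Fin d → ℤ) : intVec (k + l) = intVec k + intVec l := by ext i; simp

lemma intVec_sub (k l : Fin d → ℤ) : intVec (k - l) = intVec k - intVec l := by ext i; simp

lemma scale_add (a : Fin d → ℝ) (x y : EuclideanSpace ℝ (Fin d)) :
    scale a (x + y) = scale a x + scale a y := by ext i; simp [mul_add]

lemma continuous_scale (a : Fin d → ℝ) : Continuous (scale a) := by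
  unfold scale; fun_prop

lemma continuous_intVec_add (a : Fin d → ℝ) (b : Fin d → ℤ) :
    Continuous fun x => scale a (intVec b + x) :=
  (continuous_scale a).comp (by fun_prop)

lemma isCompact_cube : IsCompact (cube d) := by
  have h : cube d = (WithLp.toLp 2) '' (Set.univ.pi fun _ : Fin d => Set.Icc (0 : ℝ) 1) := by
    ext x
    constructor
    · intro hx
      exact ⟨x.ofLp, fun i _ => hx i, rfl⟩
    · rintro ⟨y, hy, rfl⟩ i
      exact hy i (Set.mem_univ i)
  rw [h]
  exact (isCompact_univ_pi fun _ => isCompact_Icc).image (by fun_prop)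

lemma inner_eq_sum (ξ x : EuclideanSpace ℝ (Fin d)) : inner ℝ ξ x = ∑ i, ξ i * x i := by
  simp [PiLp.inner_apply, mul_comm]

lemma expFun_scale (a : Fin d → ℝ) (ξ x : EuclideanSpace ℝ (Fin d)) :
    expFun (scale a ξ) x = expFun ξ (scale a x) := by
  simp only [expFun, inner_eq_sum, scale_apply]
  congr 4
  funext i
  ring

lemma expFun_add_left (ξ η x : EuclideanSpace ℝ (Fin d)) :
    expFun (ξ + η) x = expFun ξ x * expFun η x := by
  simp only [expFun, inner_add_left, ← Complex.exp_add]; push_cast; ring_nf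

lemma expFun_add_right (ξ x y : EuclideanSpace ℝ (Fin d)) :
    expFun ξ (x + y) = expFun ξ x * expFun ξ y := by
  simp only [expFun, inner_add_right, ← Complex.exp_add]; push_cast; ring_nf

@[simp] lemma expFun_zero_left (x : EuclideanSpace ℝ (Fin d)) : expFun 0 x = 1 := by simp [expFun]

@[simp] lemma expFun_zero_right (x : EuclideanSpace ℝ (Fin d)) : expFun x 0 = 1 := by simp [expFun]

lemma expFun_eq (ξ x : EuclideanSpace ℝ (Fin d)) :
    expFun ξ x = Complex.exp ((2 * Real.pi * inner ℝ ξ x : ℝ) * Complex.I) := by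
  simp only [expFun]; push_cast; ring_nf

@[simp] lemma norm_expFun (ξ x : EuclideanSpace ℝ (Fin d)) : ‖expFun ξ x‖ = 1 := by
  rw [expFun_eq, Complex.norm_exp_ofReal_mul_I]

lemma expFun_neg_left (ξ x : EuclideanSpace ℝ (Fin d)) :
    expFun (-ξ) x = (starRingEnd ℂ) (expFun ξ x) := by
  rw [expFun_eq, expFun_eq, ← Complex.exp_conj, map_mul, Complex.conj_ofReal, Complex.conj_I,
    inner_neg_left]
  push_cast
  ring_nf

lemma expFun_comm (ξ x : EuclideanSpace ℝ (Fin d)) : expFun ξ x = expFun x ξ := by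
  rw [expFun_eq, expFun_eq, real_inner_comm]

@[simp] lemma expFun_intVec (k l : Fin d → ℤ) : expFun (intVec k) (intVec l) = 1 := by
  rw [expFun, Complex.exp_eq_one_iff]
  refine ⟨∑ i, k i * l i, ?_⟩
  rw [inner_eq_sum]
  push_cast [intVec_apply]
  ring

lemma continuous_expFun (ξ : EuclideanSpace ℝ (Fin d)) : Continuous (expFun ξ) := by
  unfold expFun; fun_prop

lemma norm_expFun_sub_le (ξ η x : EuclideanSpace ℝ (Fin d)) :
    ‖expFun ξ x - expFun η x‖ ≤ 2 * Real.pi * |inner ℝ (ξ - η) x| := by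
  have h : expFun ξ x - expFun η x = expFun η x * (expFun (ξ - η) x - 1) := by
    rw [mul_sub, ← expFun_add_left]; simp
  rw [h, norm_mul, norm_expFun, one_mul, expFun_eq, mul_comm _ Complex.I]
  refine (Real.norm_exp_I_mul_ofReal_sub_one_le).trans ?_
  rw [Real.norm_eq_abs, abs_mul, abs_of_pos Real.two_pi_pos]

lemma integrable_expFun (μ : Measure (EuclideanSpace ℝ (Fin d))) [IsFiniteMeasure μ]
    (ξ : EuclideanSpace ℝ (Fin d)) : Integrable (expFun ξ) μ :=
  (integrable_const (1 : ℝ)).mono (continuous_expFun ξ).aestronglyMeasurable (by simp)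

lemma ft_eq_charFun (μ : Measure (EuclideanSpace ℝ (Fin d))) (ξ : EuclideanSpace ℝ (Fin d)) :
    ft μ ξ = charFun μ ((2 * Real.pi) • ξ) := by
  simp only [ft, charFun_apply, expFun_eq, inner_smul_right, real_inner_comm]

lemma charFun_eq_ft (μ : Measure (EuclideanSpace ℝ (Fin d))) (t : EuclideanSpace ℝ (Fin d)) :
    charFun μ t = ft μ ((2 * Real.pi)⁻¹ • t) := by
  rw [ft_eq_charFun, smul_smul, mul_inv_cancel₀ Real.two_pi_pos.ne', one_smul]

lemma norm_ft_le (μ : Measure (EuclideanSpace ℝ (Fin d))) [IsProbabilityMeasure μ]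
    (ξ : EuclideanSpace ℝ (Fin d)) : ‖ft μ ξ‖ ≤ 1 := by
  refine (norm_integral_le_integral_norm _).trans ?_
  simp

@[simp] lemma ft_zero (μ : Measure (EuclideanSpace ℝ (Fin d))) [IsProbabilityMeasure μ] :
    ft μ 0 = 1 := by simp [ft]

@[simp] lemma mask_zero {B : Finset (Fin d → ℤ)} (hB : B.Nonempty) : mask B 0 = 1 := by
  have : (B.card : ℂ) ≠ 0 := by simpa using hB.ne_empty
  simp [mask, this]

lemma norm_mask_le (B : Finset (Fin d → ℤ)) (ξ : EuclideanSpace ℝ (Fin d)) : ‖mask B ξ‖ ≤ 1 := by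
  rw [mask, norm_mul, norm_inv, Complex.norm_natCast]
  have : ‖∑ b ∈ B, expFun ξ (intVec b)‖ ≤ B.card := by
    refine (norm_sum_le _ _).trans ?_
    simp
  rcases B.card.eq_zero_or_pos with h | h
  · simp [h]
  · rw [inv_mul_le_iff₀ (by positivity)]; simpa using this

lemma mask_add_intVec (B : Finset (Fin d → ℤ)) (ξ : EuclideanSpace ℝ (Fin d)) (k : Fin d → ℤ) :
    mask B (ξ + intVec k) = mask B ξ := by
  simp [mask, expFun_add_left]

lemma continuous_mask (B : Finset (Fin d → ℤ)) : Continuous (mask B) := by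
  unfold mask
  refine continuous_const.mul (continuous_finsetSum _ fun b _ => ?_)
  simp_rw [fun ξ => expFun_comm ξ (intVec b)]
  exact continuous_expFun _

lemma exists_norm_cube_le (d : ℕ) : ∃ C : ℝ, 0 < C ∧ ∀ x ∈ cube d, ‖x‖ ≤ C := by
  obtain ⟨C, hC⟩ := (isCompact_cube (d := d)).isBounded.exists_norm_le
  exact ⟨max C 1, by positivity, fun x hx => (hC x hx).trans (le_max_left _ _)⟩

/-- The Lipschitz constant depends on the cube only, so all measures carried by it have
equicontinuous transforms; the compactness argument and the radius in equi-positivity rest on this.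
-/
lemma norm_ft_sub_le {C : ℝ} (hC : ∀ x ∈ cube d, ‖x‖ ≤ C)
    (μ : Measure (EuclideanSpace ℝ (Fin d))) [IsProbabilityMeasure μ] (hμ : μ (cube d)ᶜ = 0)
    (ξ η : EuclideanSpace ℝ (Fin d)) : ‖ft μ ξ - ft μ η‖ ≤ 2 * Real.pi * C * ‖ξ - η‖ := by
  rw [ft, ft, ← integral_sub (integrable_expFun μ ξ) (integrable_expFun μ η)]
  have h : ∀ᵐ x ∂μ, ‖expFun ξ x - expFun η x‖ ≤ 2 * Real.pi * C * ‖ξ - η‖ := by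
    have hc : ∀ᵐ x ∂μ, x ∈ cube d := hμ
    filter_upwards [hc] with x hx
    refine (norm_expFun_sub_le ξ η x).trans ?_
    have h1 := (abs_real_inner_le_norm (ξ - η) x).trans
      (mul_le_mul_of_nonneg_left (hC x hx) (norm_nonneg _))
    have := mul_le_mul_of_nonneg_left h1 Real.two_pi_pos.le
    linarith
  simpa using norm_integral_le_of_norm_le_const h

/-! ### Totality of exponentials in L²(μ) and the Parseval criterion. -/

lemma memLp_expFun (μ : Measure (EuclideanSpace ℝ (Fin d))) [IsFiniteMeasure μ]
    (ξ : EuclideanSpace ℝ (Fin d)) : MemLp (expFun ξ) 2 μ :=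
  MemLp.of_bound (continuous_expFun ξ).aestronglyMeasurable 1 (by simp)

/-- The exponential `e_ξ` as an element of `L²(μ)`. -/
def expLp (μ : Measure (EuclideanSpace ℝ (Fin d))) [IsFiniteMeasure μ]
    (ξ : EuclideanSpace ℝ (Fin d)) : Lp ℂ 2 μ := (memLp_expFun μ ξ).toLp _

lemma coeFn_expLp (μ : Measure (EuclideanSpace ℝ (Fin d))) [IsFiniteMeasure μ]
    (ξ : EuclideanSpace ℝ (Fin d)) : expLp μ ξ =ᵐ[μ] expFun ξ := MemLp.coeFn_toLp _

lemma inner_expLp (μ : Measure (EuclideanSpace ℝ (Fin d))) [IsFiniteMeasure μ]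
    (ξ η : EuclideanSpace ℝ (Fin d)) : inner ℂ (expLp μ ξ) (expLp μ η) = ft μ (η - ξ) := by
  rw [L2.inner_def, ft]
  refine integral_congr_ae ?_
  filter_upwards [coeFn_expLp μ ξ, coeFn_expLp μ η] with x h1 h2
  rw [h1, h2, sub_eq_add_neg, expFun_add_left, expFun_neg_left]
  simp

/-- A real integrable function all of whose exponential integrals vanish is zero. -/
lemma ae_eq_zero_of_integral_expFun_real {μ : Measure (EuclideanSpace ℝ (Fin d))}
    [IsFiniteMeasure μ] {u : EuclideanSpace ℝ (Fin d) → ℝ} (hu : Integrable u μ)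
    (h : ∀ ξ, ∫ x, (u x : ℂ) * expFun ξ x ∂μ = 0) : u =ᵐ[μ] 0 := by
  have hp : AEMeasurable (fun x => (u x).toNNReal) μ := hu.aemeasurable.real_toNNReal
  have hm : AEMeasurable (fun x => (-u x).toNNReal) μ := hu.aemeasurable.neg.real_toNNReal
  have fp : IsFiniteMeasure (μ.withDensity fun x => ((u x).toNNReal : ℝ≥0∞)) :=
    isFiniteMeasure_withDensity_ofReal hu.2
  have fm : IsFiniteMeasure (μ.withDensity fun x => ((-u x).toNNReal : ℝ≥0∞)) :=
    isFiniteMeasure_withDensity_ofReal hu.neg.2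
  -- The positive and negative parts of u are densities of two finite measures with equal
  -- characteristic functions, hence of equal measures.
  have key : (μ.withDensity fun x => ((u x).toNNReal : ℝ≥0∞)) =
      μ.withDensity fun x => ((-u x).toNNReal : ℝ≥0∞) := by
    refine Measure.ext_of_charFun (funext fun t => ?_)
    rw [charFun_eq_ft, charFun_eq_ft, ft, ft, integral_withDensity_eq_integral_smul₀ hp,
      integral_withDensity_eq_integral_smul₀ hm, ← sub_eq_zero, ← integral_sub]
    · rw [← h ((2 * Real.pi)⁻¹ • t)]
      refine integral_congr_ae (.of_forall fun x => ?_)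
      rcases le_total 0 (u x) with h0 | h0 <;> simp [NNReal.smul_def, h0]
    · refine Integrable.mono hu (AEStronglyMeasurable.smul hp.coe_nnreal_real.aestronglyMeasurable
        (continuous_expFun _).aestronglyMeasurable) (.of_forall fun x => ?_)
      simp only [NNReal.smul_def, norm_smul, norm_expFun, mul_one, Real.coe_toNNReal',
        Real.norm_eq_abs, abs_of_nonneg (le_max_right (u x) 0)]
      exact max_le (le_abs_self _) (abs_nonneg _)
    · refine Integrable.mono hu (AEStronglyMeasurable.smul hm.coe_nnreal_real.aestronglyMeasurable
        (continuous_expFun _).aestronglyMeasurable) (.of_forall fun x => ?_)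
      simp only [NNReal.smul_def, norm_smul, norm_expFun, mul_one, Real.coe_toNNReal',
        Real.norm_eq_abs, abs_of_nonneg (le_max_right (-u x) 0)]
      exact max_le (neg_le_abs _) (abs_nonneg _)
  rw [withDensity_eq_iff hp.coe_nnreal_ennreal hm.coe_nnreal_ennreal] at key
  · filter_upwards [key] with x hx
    have hx' : (u x).toNNReal = (-u x).toNNReal := by exact_mod_cast hx
    have h3 := congrArg NNReal.toReal hx'
    simp only [Real.coe_toNNReal'] at h3
    have := max_zero_sub_max_neg_zero_eq_self (u x)
    rw [h3, sub_self] at this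
    exact this.symm
  · have := fp.1.ne
    simpa [withDensity_apply] using this

lemma ae_eq_zero_of_integral_expFun {μ : Measure (EuclideanSpace ℝ (Fin d))}
    [IsFiniteMeasure μ] {f : EuclideanSpace ℝ (Fin d) → ℂ} (hf : Integrable f μ)
    (h : ∀ ξ, ∫ x, f x * expFun ξ x ∂μ = 0) : f =ᵐ[μ] 0 := by
  have hint : ∀ ξ, Integrable (fun x => f x * expFun ξ x) μ := fun ξ =>
    hf.mono (hf.1.mul (continuous_expFun ξ).aestronglyMeasurable) (by simp)
  have hc : ∀ ξ, ∫ x, (starRingEnd ℂ) (f x) * expFun ξ x ∂μ = 0 := fun ξ => by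
    have := congrArg (starRingEnd ℂ) (h (-ξ))
    rw [← integral_conj, map_zero] at this
    simpa [expFun_neg_left] using this
  have hcint : ∀ ξ, Integrable (fun x => (starRingEnd ℂ) (f x) * expFun ξ x) μ := fun ξ =>
    hf.mono ((Complex.continuous_conj.comp_aestronglyMeasurable hf.1).mul
      (continuous_expFun ξ).aestronglyMeasurable) (by simp)
  have hre : (fun x => (f x).re) =ᵐ[μ] 0 := by
    refine ae_eq_zero_of_integral_expFun_real hf.re fun ξ => ?_
    have : ∀ x, ((f x).re : ℂ) * expFun ξ x =
        2⁻¹ * (f x * expFun ξ x + (starRingEnd ℂ) (f x) * expFun ξ x) := fun x => by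
      rw [Complex.re_eq_add_conj]; ring
    simp_rw [this]
    rw [integral_const_mul, integral_add (hint ξ) (hcint ξ), h, hc]; simp
  have him : (fun x => (f x).im) =ᵐ[μ] 0 := by
    refine ae_eq_zero_of_integral_expFun_real hf.im fun ξ => ?_
    have : ∀ x, ((f x).im : ℂ) * expFun ξ x =
        (2 * Complex.I)⁻¹ * (f x * expFun ξ x - (starRingEnd ℂ) (f x) * expFun ξ x) := fun x => by
      rw [Complex.im_eq_sub_conj]; ring
    simp_rw [this]
    rw [integral_const_mul, integral_sub (hint ξ) (hcint ξ), h, hc]; simp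
  filter_upwards [hre, him] with x h1 h2
  exact Complex.ext h1 h2

lemma norm_ft_neg (μ : Measure (EuclideanSpace ℝ (Fin d))) (ξ : EuclideanSpace ℝ (Fin d)) :
    ‖ft μ (-ξ)‖ = ‖ft μ ξ‖ := by
  rw [ft, ft]
  simp_rw [expFun_neg_left]
  rw [integral_conj, RCLike.norm_conj]

/-- Bessel's inequality with its exact defect, so that Parseval's identity for x says that the
partial expansions converge to x. -/
lemma norm_sub_sum_sq {V ι : Type*} [NormedAddCommGroup V] [InnerProductSpace ℂ V] {v : ι → V}
    (hv : Orthonormal ℂ v) (s : Finset ι) (x : V) :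
    ‖x - ∑ i ∈ s, inner ℂ (v i) x • v i‖ ^ 2 = ‖x‖ ^ 2 - ∑ i ∈ s, ‖inner ℂ (v i) x‖ ^ 2 := by
  have h3 : ∀ z : ℂ, RCLike.re (z * (starRingEnd ℂ) z) = ‖z‖ ^ 2 := by
    intro z
    simp only [RCLike.mul_conj]
    norm_cast
  have h2 : (∑ i ∈ s, ∑ j ∈ s, inner ℂ (v i) x * inner ℂ x (v j) * inner ℂ (v j) (v i)) =
      ∑ k ∈ s, inner ℂ (v k) x * inner ℂ x (v k) := hv.inner_left_right_finset
  rw [@norm_sub_sq ℂ, sub_add]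
  simp only [@InnerProductSpace.norm_sq_eq_re_inner ℂ V, inner_sum, sum_inner]
  simp only [inner_smul_right, two_mul, inner_smul_left, inner_conj_symm, ← mul_assoc,
    h2, add_sub_cancel_right, sub_right_inj]
  simp only [map_sum, ← inner_conj_symm x, ← h3]

/-- A countable orthogonal family of exponentials satisfying Parseval's identity for every
exponential is a spectrum. -/
theorem isSpectrum_of_hasSum {μ : Measure (EuclideanSpace ℝ (Fin d))} [IsProbabilityMeasure μ]
    {S : Set (EuclideanSpace ℝ (Fin d))} (hS : S.Countable)
    (horth : ∀ a ∈ S, ∀ b ∈ S, a ≠ b → ft μ (b - a) = 0)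
    (hsum : ∀ ξ, HasSum (fun a : S => ‖ft μ (ξ + a)‖ ^ 2) 1) : IsSpectrum μ S := by
  have hon : Orthonormal ℂ (fun a : S => expLp μ a) := by
    classical
    rw [orthonormal_iff_ite]
    intro a b
    rw [inner_expLp]
    split_ifs with hab
    · simp [hab]
    · exact horth a a.2 b b.2 fun h => hab (Subtype.ext h)
  have hbot : (Submodule.span ℂ (Set.range fun a : S => expLp μ a))ᗮ = ⊥ := by
    rw [Submodule.eq_bot_iff]
    intro f hf
    have hf' : ∀ a : S, inner ℂ (expLp μ a) f = 0 := fun a =>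
      (Submodule.mem_orthogonal _ _).1 hf _ (Submodule.subset_span ⟨a, rfl⟩)
    have hall : ∀ ξ, inner ℂ (expLp μ ξ) f = 0 := by
      intro ξ
      -- The coefficients of e_ξ are the transforms at ξ - a, of the same modulus as those at -ξ +
      -- a; hence the sign.
      have hlim := ((hsum (-ξ)).const_sub (1 : ℝ)).mul_const (‖f‖ ^ 2)
      rw [sub_self, zero_mul] at hlim
      have hle : ∀ s : Finset S, ‖inner ℂ (expLp μ ξ) f‖ ^ 2 ≤
          (1 - ∑ a ∈ s, ‖ft μ (-ξ + a)‖ ^ 2) * ‖f‖ ^ 2 := by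
        intro s
        -- Since f is orthogonal to every e_a, it sees only the remainder of e_ξ, whose norm tends
        -- to zero.
        set g := expLp μ ξ - ∑ a ∈ s, inner ℂ (expLp μ a) (expLp μ ξ) • expLp μ a with hg
        have h1 : inner ℂ (expLp μ ξ) f = inner ℂ g f := by
          rw [hg, inner_sub_left, sum_inner]
          simp [inner_smul_left, hf']
        have h2 : ‖g‖ ^ 2 = 1 - ∑ a ∈ s, ‖ft μ (-ξ + a)‖ ^ 2 := by
          rw [hg, norm_sub_sum_sq hon, @norm_sq_eq_re_inner ℂ, inner_expLp]
          simp_rw [inner_expLp, ← norm_ft_neg μ (ξ - _)]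
          simp [sub_eq_neg_add, add_comm]
        rw [h1, ← h2, ← mul_pow]
        exact pow_le_pow_left₀ (norm_nonneg _) (norm_inner_le_norm _ _) 2
      have := ge_of_tendsto' hlim hle
      simpa using this
    rw [Lp.eq_zero_iff_ae_eq_zero]
    refine ae_eq_zero_of_integral_expFun ((Lp.memLp f).integrable (by norm_num)) fun ξ => ?_
    rw [← hall (-ξ), L2.inner_def]
    refine integral_congr_ae ?_
    filter_upwards [coeFn_expLp μ (-ξ)] with x hx
    rw [hx, expFun_neg_left]
    simp
  refine ⟨hS, HilbertBasis.mkOfOrthogonalEqBot hon hbot, fun ξ => ?_⟩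
  rw [HilbertBasis.coe_mkOfOrthogonalEqBot]
  exact coeFn_expLp μ ξ

/-! ### Diagonal dilations and products of masks. -/

/-- Division of the coordinates of `x` by the integers `m i`. -/
def invScale (m : Fin d → ℤ) (x : EuclideanSpace ℝ (Fin d)) : EuclideanSpace ℝ (Fin d) :=
  scale (fun i => (m i : ℝ)⁻¹) x

/-- The diagonal of the product of the first `n` diagonal matrices. -/
def diagProd (r : ℕ → Fin d → ℤ) (n : ℕ) : Fin d → ℤ := ∏ j ∈ Finset.range n, r j

/-- The Fourier transform of the `n`-th finite convolution. -/
def maskProd (r : ℕ → Fin d → ℤ) (B : ℕ → Finset (Fin d → ℤ)) (n : ℕ)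
    (ξ : EuclideanSpace ℝ (Fin d)) : ℂ :=
  ∏ j ∈ Finset.range n, mask (B j) (invScale (diagProd r (j + 1)) ξ)

/-- The translates of `‖φ‖²` by the elements of `Λ` sum to one. -/
def IsTile (φ : EuclideanSpace ℝ (Fin d) → ℂ) (Λ : Finset (Fin d → ℤ)) : Prop :=
  ∀ ξ, ∑ l ∈ Λ, ‖φ (ξ + intVec l)‖ ^ 2 = 1

@[simp] lemma invScale_apply (m : Fin d → ℤ) (x : EuclideanSpace ℝ (Fin d)) (i : Fin d) :
    invScale m x i = x i / m i := by
  rw [invScale, scale_apply, div_eq_inv_mul]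

lemma invScale_add (m : Fin d → ℤ) (x y : EuclideanSpace ℝ (Fin d)) :
    invScale m (x + y) = invScale m x + invScale m y := scale_add _ _ _

@[simp] lemma invScale_zero (m : Fin d → ℤ) : invScale m 0 = 0 := by ext i; simp

@[simp] lemma invScale_one (x : EuclideanSpace ℝ (Fin d)) : invScale 1 x = x := by ext i; simp

lemma invScale_invScale (m n : Fin d → ℤ) (x : EuclideanSpace ℝ (Fin d)) :
    invScale m (invScale n x) = invScale (n * m) x := by
  ext i; simp [div_div]

lemma invScale_intVec_mul {m : Fin d → ℤ} (hm : ∀ i, m i ≠ 0) (k : Fin d → ℤ) :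
    invScale m (intVec (m * k)) = intVec k := by
  ext i
  have : (m i : ℝ) ≠ 0 := by exact_mod_cast hm i
  simp [this]

lemma diagProd_succ (r : ℕ → Fin d → ℤ) (n : ℕ) : diagProd r (n + 1) = diagProd r n * r n :=
  Finset.prod_range_succ _ _

@[simp] lemma diagProd_zero (r : ℕ → Fin d → ℤ) : diagProd r 0 = 1 := rfl

lemma diagProd_add (r : ℕ → Fin d → ℤ) (n k : ℕ) :
    diagProd r (n + k) = diagProd r n * diagProd (fun j => r (n + j)) k :=
  Finset.prod_range_add _ _ _

lemma two_pow_le_diagProd {r : ℕ → Fin d → ℤ} (hr : ∀ n i, 2 ≤ r n i) (n : ℕ) (i : Fin d) :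
    2 ^ n ≤ diagProd r n i := by
  induction n with
  | zero => simp
  | succ n ih =>
    rw [diagProd_succ, Pi.mul_apply, pow_succ]
    exact mul_le_mul ih (hr n i) (by norm_num) (le_trans (by positivity) ih)

lemma diagProd_pos {r : ℕ → Fin d → ℤ} (hr : ∀ n i, 2 ≤ r n i) (n : ℕ) (i : Fin d) :
    0 < diagProd r n i := lt_of_lt_of_le (by positivity) (two_pow_le_diagProd hr n i)

lemma tendsto_invScale_diagProd {r : ℕ → Fin d → ℤ} (hr : ∀ n i, 2 ≤ r n i)
    (x : EuclideanSpace ℝ (Fin d)) :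
    Tendsto (fun n => invScale (diagProd r n) x) atTop (𝓝 0) := by
  have h : Tendsto (fun n => (invScale (diagProd r n) x).ofLp) atTop (𝓝 0) := by
    rw [tendsto_pi_nhds]
    intro i
    simp only [invScale_apply, Pi.zero_apply]
    refine Tendsto.const_div_atTop (tendsto_atTop_mono (fun n => ?_)
      (tendsto_pow_atTop_atTop_of_one_lt (one_lt_two (α := ℝ)))) _
    exact_mod_cast two_pow_le_diagProd hr n i
  have := ((PiLp.continuous_toLp 2 fun _ : Fin d => ℝ).tendsto 0).comp h
  simpa [Function.comp_def] using this

@[simp] lemma maskProd_zero (r : ℕ → Fin d → ℤ) (B : ℕ → Finset (Fin d → ℤ))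
    (ξ : EuclideanSpace ℝ (Fin d)) : maskProd r B 0 ξ = 1 := rfl

lemma maskProd_succ (r : ℕ → Fin d → ℤ) (B : ℕ → Finset (Fin d → ℤ)) (n : ℕ)
    (ξ : EuclideanSpace ℝ (Fin d)) : maskProd r B (n + 1) ξ =
      maskProd r B n ξ * mask (B n) (invScale (r n) (invScale (diagProd r n) ξ)) := by
  rw [invScale_invScale, ← diagProd_succ]
  exact Finset.prod_range_succ _ _

lemma maskProd_add (r : ℕ → Fin d → ℤ) (B : ℕ → Finset (Fin d → ℤ)) (n k : ℕ)
    (ξ : EuclideanSpace ℝ (Fin d)) : maskProd r B (n + k) ξ = maskProd r B n ξ *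
      maskProd (fun j => r (n + j)) (fun j => B (n + j)) k (invScale (diagProd r n) ξ) := by
  simp only [maskProd, invScale_invScale, ← diagProd_add]
  exact Finset.prod_range_add _ _ _

lemma maskProd_at_zero {B : ℕ → Finset (Fin d → ℤ)} (hB : ∀ n, (B n).Nonempty)
    (r : ℕ → Fin d → ℤ) (n : ℕ) : maskProd r B n 0 = 1 := by
  simp [maskProd, hB]

lemma norm_maskProd_le (r : ℕ → Fin d → ℤ) (B : ℕ → Finset (Fin d → ℤ)) (n : ℕ)
    (ξ : EuclideanSpace ℝ (Fin d)) : ‖maskProd r B n ξ‖ ≤ 1 := by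
  rw [maskProd, norm_prod]
  exact Finset.prod_le_one (fun _ _ => norm_nonneg _) fun _ _ => norm_mask_le _ _

/-- This is the freedom in the construction: a frequency can be moved within its coset modulo
`diagProd r n` without affecting the tile at level n. -/
lemma maskProd_periodic {r : ℕ → Fin d → ℤ} (hr : ∀ n i, 2 ≤ r n i)
    (B : ℕ → Finset (Fin d → ℤ)) (n : ℕ) (ξ : EuclideanSpace ℝ (Fin d)) (k : Fin d → ℤ) :
    maskProd r B n (ξ + intVec (diagProd r n * k)) = maskProd r B n ξ := by
  induction n generalizing k with
  | zero => simp
  | succ n ih =>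
    have h1 : diagProd r (n + 1) * k = diagProd r n * (r n * k) := by
      rw [diagProd_succ, mul_assoc]
    rw [maskProd_succ, maskProd_succ, h1, ih, invScale_add,
      invScale_intVec_mul fun i => (diagProd_pos hr n i).ne', invScale_add,
      invScale_intVec_mul fun i => (by linarith [hr n i] : (0 : ℤ) < r n i).ne', mask_add_intVec]

/-! ### Tiles, their extension, and the limit set of frequencies. -/

/-- A family of integer translates with the tiling property has no repetitions. -/
lemma isTile_image {ι : Type*} [DecidableEq (Fin d → ℤ)] {φ : EuclideanSpace ℝ (Fin d) → ℂ}
    (h0 : ‖φ 0‖ = 1) {s : Finset ι} {g : ι → Fin d → ℤ}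
    (h : ∀ ξ, ∑ i ∈ s, ‖φ (ξ + intVec (g i))‖ ^ 2 = 1) : IsTile φ (s.image g) := by
  classical
  intro ξ
  rw [Finset.sum_image, h]
  intro i hi j hj hij
  -- At ξ = -g(i), a repeated value would contribute ‖φ 0‖² = 1 twice to a sum equal to 1.
  by_contra hne
  have h1 := h (-intVec (g i))
  have h2 := Finset.sum_le_sum_of_subset_of_nonneg (f := fun i' =>
    ‖φ (-intVec (g i) + intVec (g i'))‖ ^ 2) (s := {i, j}) (t := s)
    (by simpa [Finset.insert_subset_iff] using ⟨hi, hj⟩) (fun _ _ _ => by positivity)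
  rw [h1, Finset.sum_pair hne, ← hij] at h2
  simp [h0] at h2
  linarith

/-- At ξ = -a the term of a alone already exhausts the total 1, so all other terms vanish. -/
lemma IsTile.eq_zero_of_ne {φ : EuclideanSpace ℝ (Fin d) → ℂ} {Λ : Finset (Fin d → ℤ)}
    (h : IsTile φ Λ) (h0 : ‖φ 0‖ = 1) {a b : Fin d → ℤ} (ha : a ∈ Λ) (hb : b ∈ Λ)
    (hab : a ≠ b) : φ (intVec b - intVec a) = 0 := by
  classical
  have h1 := h (-intVec a)
  have h2 := Finset.sum_le_sum_of_subset_of_nonneg (f := fun i' =>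
    ‖φ (-intVec a + intVec i')‖ ^ 2) (s := {a, b}) (t := Λ)
    (by simpa [Finset.insert_subset_iff] using ⟨ha, hb⟩) (fun _ _ _ => by positivity)
  rw [h1, Finset.sum_pair hab] at h2
  simp only [neg_add_cancel, h0, one_pow] at h2
  rw [← norm_eq_zero, sub_eq_neg_add]
  have h3 : ‖φ (-intVec a + intVec b)‖ ^ 2 ≤ 0 := by linarith
  exact pow_eq_zero_iff two_ne_zero |>.1 (le_antisymm h3 (by positivity))

/-- The new tile is Λ + P_n L. By periodicity the first n factors do not see the P_n L part, so the
sum over L of the last factor is 1 for each fixed element of Λ. Having 0 in L makes the tiles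
nested. -/
lemma IsTile.exists_succ {r : ℕ → Fin d → ℤ} (hr : ∀ n i, 2 ≤ r n i)
    {B : ℕ → Finset (Fin d → ℤ)} (hB : ∀ n, (B n).Nonempty) {n : ℕ} {L : Finset (Fin d → ℤ)}
    (hL0 : 0 ∈ L) (hL : IsTile (fun ξ => mask (B n) (invScale (r n) ξ)) L)
    {Λ : Finset (Fin d → ℤ)} (hΛ : IsTile (maskProd r B n) Λ) :
    ∃ Λ', Λ ⊆ Λ' ∧ IsTile (maskProd r B (n + 1)) Λ' := by
  classical
  refine ⟨(Λ ×ˢ L).image fun q => q.1 + diagProd r n * q.2, fun l hl => ?_, ?_⟩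
  · exact Finset.mem_image.2 ⟨(l, 0), by simp [hl, hL0], by simp⟩
  · refine isTile_image (by simp [maskProd_at_zero hB]) fun ξ => ?_
    rw [Finset.sum_product, ← hΛ ξ]
    refine Finset.sum_congr rfl fun l _ => ?_
    have h1 : ∀ k, ‖maskProd r B (n + 1) (ξ + intVec (l + diagProd r n * k))‖ ^ 2 =
        ‖maskProd r B n (ξ + intVec l)‖ ^ 2 * ‖mask (B n) (invScale (r n)
          (invScale (diagProd r n) (ξ + intVec l) + intVec k))‖ ^ 2 := fun k => by
      rw [maskProd_succ, intVec_add, ← add_assoc, maskProd_periodic hr, norm_mul, mul_pow,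
        invScale_add _ (ξ + _), invScale_intVec_mul fun i => (diagProd_pos hr n i).ne']
    simp_rw [h1]
    rw [← Finset.mul_sum, hL, mul_one]

lemma IsTile.exists_extension {r : ℕ → Fin d → ℤ} (hr : ∀ n i, 2 ≤ r n i)
    {B : ℕ → Finset (Fin d → ℤ)} (hB : ∀ n, (B n).Nonempty)
    (hL : ∀ n, ∃ L, 0 ∈ L ∧ IsTile (fun ξ => mask (B n) (invScale (r n) ξ)) L)
    {n : ℕ} {Λ : Finset (Fin d → ℤ)} (hΛ : IsTile (maskProd r B n) Λ) {n' : ℕ} (hn : n ≤ n') :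
    ∃ Λ', Λ ⊆ Λ' ∧ IsTile (maskProd r B n') Λ' := by
  induction n', hn using Nat.le_induction with
  | base => exact ⟨Λ, subset_rfl, hΛ⟩
  | succ k _ ih =>
    obtain ⟨Λ₁, h1, h2⟩ := ih
    obtain ⟨L, h3, h4⟩ := hL k
    obtain ⟨Λ₂, h5, h6⟩ := IsTile.exists_succ (r := r) (B := B) (n := k) hr hB h3 h4 h2
    exact ⟨Λ₂, h1.trans h5, h6⟩

/-- The functions `φ n`, `n ∈ G`, are bounded below near suitable integer translates of any
point, and near the origin. -/
def IsEquiPositive (φ : ℕ → EuclideanSpace ℝ (Fin d) → ℂ) (G : Set ℕ) (ε δ : ℝ) : Prop :=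
  ∀ n ∈ G, (∀ y, ‖y‖ < δ → ε ≤ ‖φ n y‖) ∧
    ∀ x, ∃ k : Fin d → ℤ, ∀ y, ‖y‖ < δ → ε ≤ ‖φ n (x + intVec k + y)‖

/-- Old frequencies must stay fixed: n' is taken so large that after rescaling they lie within δ/2
of the origin, where φ is bounded below. Each new one is moved by a multiple of `diagProd r n'` to a
place where equi-positivity applies. The remaining δ/2 is kept for the variable ξ of Parseval's
identity. -/
lemma IsTile.exists_extension_lower_bound {r : ℕ → Fin d → ℤ} (hr : ∀ n i, 2 ≤ r n i)
    {B : ℕ → Finset (Fin d → ℤ)} (hB : ∀ n, (B n).Nonempty)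
    (hL : ∀ n, ∃ L, 0 ∈ L ∧ IsTile (fun ξ => mask (B n) (invScale (r n) ξ)) L)
    {φ : ℕ → EuclideanSpace ℝ (Fin d) → ℂ} {G : Set ℕ} (hG : G.Infinite) {ε δ : ℝ} (hδ : 0 < δ)
    (hφ : IsEquiPositive φ G ε δ)
    {n : ℕ} {Λ : Finset (Fin d → ℤ)} (hΛ : IsTile (maskProd r B n) Λ) :
    ∃ n' Λ', n < n' ∧ Λ ⊆ Λ' ∧ IsTile (maskProd r B n') Λ' ∧ ∀ l ∈ Λ', ∀ y, ‖y‖ < δ / 2 →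
      ε ≤ ‖φ n' (invScale (diagProd r n') (intVec l) + y)‖ := by
  classical
  have hev : ∀ᶠ n' in atTop, ∀ l ∈ Λ, ‖invScale (diagProd r n') (intVec l)‖ < δ / 2 := by
    rw [Filter.eventually_all_finset]
    intro l _
    have := (tendsto_invScale_diagProd hr (intVec l)).norm
    rw [norm_zero] at this
    exact this.eventually_lt_const (by positivity)
  obtain ⟨N, hN⟩ := eventually_atTop.1 hev
  obtain ⟨n', hn'G, hn'⟩ := hG.exists_gt (max N n)
  obtain ⟨Λ₁, h1, h2⟩ := hΛ.exists_extension hr hB hL ((le_max_right N n).trans hn'.le)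
  choose k hk using fun x => (hφ n' hn'G).2 x
  set g : (Fin d → ℤ) → Fin d → ℤ := fun l => if l ∈ Λ then 0 else
    k (invScale (diagProd r n') (intVec l)) with hg
  refine ⟨n', Λ₁.image fun l => l + diagProd r n' * g l, (le_max_right N n).trans_lt hn',
    fun l hl => Finset.mem_image.2 ⟨l, h1 hl, by simp [hg, hl]⟩,
    isTile_image (by simp [maskProd_at_zero hB]) fun ξ => ?_, ?_⟩
  · rw [← h2 ξ]
    refine Finset.sum_congr rfl fun l _ => ?_
    rw [intVec_add, ← add_assoc, maskProd_periodic hr]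
  · intro l' hl' y hy
    obtain ⟨l, -, rfl⟩ := Finset.mem_image.1 hl'
    rw [intVec_add, invScale_add, invScale_intVec_mul fun i => (diagProd_pos hr n' i).ne']
    by_cases hl : l ∈ Λ
    · have hgl : g l = 0 := by simp [hg, hl]
      rw [hgl, intVec_zero, add_zero]
      refine (hφ n' hn'G).1 _ ((norm_add_le _ _).trans_lt ?_)
      linarith [hN n' ((le_max_left N n).trans hn'.le) l hl]
    · have hgl : g l = k (invScale (diagProd r n') (intVec l)) := by simp [hg, hl]
      rw [hgl]
      exact hk _ y (by linarith)

/-- If the tails `φ n` are equi-positive along an infinite set of indices, there is a set of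
integer frequencies satisfying orthogonality and Parseval's identity. -/
theorem exists_orthogonal_hasSum {r : ℕ → Fin d → ℤ} (hr : ∀ n i, 2 ≤ r n i)
    {B : ℕ → Finset (Fin d → ℤ)} (hB : ∀ n, (B n).Nonempty)
    (hL : ∀ n, ∃ L, 0 ∈ L ∧ IsTile (fun ξ => mask (B n) (invScale (r n) ξ)) L)
    {φ : ℕ → EuclideanSpace ℝ (Fin d) → ℂ} {Φ : EuclideanSpace ℝ (Fin d) → ℂ}
    (hφ1 : ∀ n ξ, ‖φ n ξ‖ ≤ 1)
    (hΦ : ∀ n ξ, Φ ξ = maskProd r B n ξ * φ n (invScale (diagProd r n) ξ))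
    (hlim : ∀ ξ, Tendsto (fun n => maskProd r B n ξ) atTop (𝓝 (Φ ξ)))
    {G : Set ℕ} (hG : G.Infinite) {ε δ : ℝ} (hε : 0 < ε) (hδ : 0 < δ)
    (hφ : IsEquiPositive φ G ε δ) :
    ∃ Λ : Set (Fin d → ℤ), (∀ a ∈ Λ, ∀ b ∈ Λ, a ≠ b → Φ (intVec b - intVec a) = 0) ∧
      ∀ ξ, HasSum (fun a : Λ => ‖Φ (ξ + intVec a)‖ ^ 2) 1 := by
  classical
  have step : ∀ q : {q : ℕ × Finset (Fin d → ℤ) // IsTile (maskProd r B q.1) q.2},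
      ∃ q' : {q : ℕ × Finset (Fin d → ℤ) // IsTile (maskProd r B q.1) q.2},
        q.1.1 < q'.1.1 ∧ q.1.2 ⊆ q'.1.2 ∧ ∀ l ∈ q'.1.2, ∀ y, ‖y‖ < δ / 2 →
          ε ≤ ‖φ q'.1.1 (invScale (diagProd r q'.1.1) (intVec l) + y)‖ := by
    rintro ⟨⟨n, Λ⟩, h⟩
    obtain ⟨n', Λ', h1, h2, h3, h4⟩ := h.exists_extension_lower_bound hr hB hL hG hδ hφ
    exact ⟨⟨(n', Λ'), h3⟩, h1, h2, h4⟩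
  choose next hnext1 hnext2 hnext3 using step
  -- The exponent j + 1 skips the initial tile {0}, so that every term is a value of `next` and has
  -- the lower bound.
  let s : ℕ → {q : ℕ × Finset (Fin d → ℤ) // IsTile (maskProd r B q.1) q.2} := fun j =>
    next^[j + 1] ⟨(0, {0}), fun ξ => by simp⟩
  have hs : ∀ j, s (j + 1) = next (s j) := fun j => Function.iterate_succ_apply' _ _ _
  have hs' : ∀ j, ∃ q, s j = next q := fun j => ⟨_, Function.iterate_succ_apply' _ _ _⟩
  have hmono : Monotone fun j => (s j).1.2 := monotone_nat_of_le_succ fun j => by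
    rw [hs]; exact hnext2 _
  have hsm : StrictMono fun j => (s j).1.1 := strictMono_nat_of_lt_succ fun j => by
    rw [hs]; exact hnext1 _
  have hlow : ∀ j, ∀ l ∈ (s j).1.2, ∀ y, ‖y‖ < δ / 2 →
      ε ≤ ‖φ (s j).1.1 (invScale (diagProd r (s j).1.1) (intVec l) + y)‖ := fun j => by
    obtain ⟨q, hq⟩ := hs' j
    rw [hq]; exact hnext3 q
  have hle : ∀ n ξ, ‖Φ ξ‖ ≤ ‖maskProd r B n ξ‖ := fun n ξ => by
    rw [hΦ n, norm_mul]
    exact mul_le_of_le_one_right (norm_nonneg _) (hφ1 _ _)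
  have hψ0 : ∀ n, ‖maskProd r B n 0‖ = 1 := fun n => by simp [maskProd_at_zero hB]
  let Λ : Set (Fin d → ℤ) := ⋃ j, ((s j).1.2 : Set (Fin d → ℤ))
  have hΛ : ∀ {a}, a ∈ Λ ↔ ∃ j, a ∈ (s j).1.2 := by simp [Λ]
  refine ⟨Λ, ?_, ?_⟩
  · intro a ha b hb hab
    obtain ⟨i, hi⟩ := hΛ.1 ha
    obtain ⟨j, hj⟩ := hΛ.1 hb
    have h := (s (max i j)).2.eq_zero_of_ne (hψ0 _) (hmono (le_max_left i j) hi)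
      (hmono (le_max_right i j) hj) hab
    rw [hΦ (s (max i j)).1.1, h, zero_mul]
  · intro ξ
    -- A finite subset of Λ lies in one of the nested tiles, and there ‖Φ‖ is at most the partial
    -- product, whose squares sum to 1.
    have hsum : Summable fun a : Λ => ‖Φ (ξ + intVec a)‖ ^ 2 := by
      refine summable_of_sum_le (c := 1) (fun a => by positivity) fun u => ?_
      have hu : ∃ j, ∀ a ∈ u, (a : Fin d → ℤ) ∈ (s j).1.2 := by
        have : ∀ a : Λ, ∀ᶠ j in atTop, (a : Fin d → ℤ) ∈ (s j).1.2 := fun a => by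
          obtain ⟨j, hj⟩ := hΛ.1 a.2
          exact eventually_atTop.2 ⟨j, fun i hi => hmono hi hj⟩
        exact ((Filter.eventually_all_finset u).2 fun a _ => this a).exists
      obtain ⟨j, hj⟩ := hu
      rw [← (s j).2 ξ, ← Finset.sum_image (f := fun a => ‖Φ (ξ + intVec a)‖ ^ 2)
        (g := ((↑) : Λ → Fin d → ℤ)) (fun a _ b _ h => Subtype.ext h)]
      refine (Finset.sum_le_sum_of_subset_of_nonneg (t := (s j).1.2) ?_
        fun _ _ _ => by positivity).trans (Finset.sum_le_sum fun a _ => ?_)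
      · intro a ha
        obtain ⟨b, hb, rfl⟩ := Finset.mem_image.1 ha
        exact hj b hb
      · exact pow_le_pow_left₀ (norm_nonneg _) (hle _ _) 2
    have hsmall : ∀ᶠ j in atTop, ‖invScale (diagProd r (s j).1.1) ξ‖ < δ / 2 := by
      have := ((tendsto_invScale_diagProd hr ξ).comp hsm.tendsto_atTop).norm
      rw [norm_zero] at this
      exact this.eventually_lt_const (by positivity)
    let f : ℕ → Λ → ℝ := fun j a =>
      if (a : Fin d → ℤ) ∈ (s j).1.2 then ‖maskProd r B (s j).1.1 (ξ + intVec a)‖ ^ 2 else 0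
    have hf1 : ∀ j, ∑' a, f j a = 1 := by
      intro j
      have : ∀ a : Λ, f j a = (fun a : Fin d → ℤ => if a ∈ (s j).1.2 then
        ‖maskProd r B (s j).1.1 (ξ + intVec a)‖ ^ 2 else 0) a := fun a => rfl
      rw [tsum_congr this, tsum_subtype Λ (fun a : Fin d → ℤ => if a ∈ (s j).1.2 then
        ‖maskProd r B (s j).1.1 (ξ + intVec a)‖ ^ 2 else 0), ← (s j).2 ξ]
      rw [tsum_eq_sum (s := (s j).1.2)]
      · refine Finset.sum_congr rfl fun a ha => ?_
        have : a ∈ Λ := hΛ.2 ⟨j, ha⟩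
        simp [this, ha]
      · intro a ha
        simp [Set.indicator, ha]
    -- Once ξ rescales to within δ/2 of 0, the tail factor of Φ is at least ε on the tile; dividing
    -- by it gives a summable bound independent of j.
    have hdom : ∀ᶠ j in atTop, ∀ a, ‖f j a‖ ≤ ‖Φ (ξ + intVec a)‖ ^ 2 * (ε ^ 2)⁻¹ := by
      filter_upwards [hsmall] with j hj a
      by_cases ha : (a : Fin d → ℤ) ∈ (s j).1.2
      · simp only [f, ha, if_true, norm_pow, norm_norm]
        rw [le_mul_inv_iff₀ (by positivity), hΦ (s j).1.1, norm_mul, mul_pow, invScale_add,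
          add_comm (invScale _ ξ)]
        gcongr
        exact hlow j a ha _ hj
      · simp only [f, ha, if_false, norm_zero]
        positivity
    have hptw : ∀ a : Λ, Tendsto (fun j => f j a) atTop (𝓝 (‖Φ (ξ + intVec a)‖ ^ 2)) := by
      intro a
      obtain ⟨i, hi⟩ := hΛ.1 a.2
      have hl : Tendsto (fun j => ‖maskProd r B (s j).1.1 (ξ + intVec a)‖ ^ 2) atTop
          (𝓝 (‖Φ (ξ + intVec a)‖ ^ 2)) :=
        ((hlim (ξ + intVec (a : Fin d → ℤ))).comp hsm.tendsto_atTop).norm.pow 2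
      refine hl.congr' ?_
      filter_upwards [eventually_ge_atTop i] with j hj
      have : (a : Fin d → ℤ) ∈ (s j).1.2 := hmono hj hi
      simp [f, this]
    have := tendsto_tsum_of_dominated_convergence (hsum.mul_right _) hptw hdom
    simp_rw [hf1] at this
    rw [tendsto_nhds_unique tendsto_const_nhds this]
    exact hsum.hasSum

/-! ### Admissible pairs as one-level tiles. -/

lemma invApply_diagonal {m : Fin d → ℤ} (hm : ∀ i, m i ≠ 0) (b : Fin d → ℤ) :
    invApply (Matrix.diagonal m) b = invScale m (intVec b) := by
  have h : (Matrix.diagonal fun i => (m i : ℝ))⁻¹ = Matrix.diagonal fun i => (m i : ℝ)⁻¹ := by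
    refine Matrix.inv_eq_left_inv ?_
    rw [Matrix.diagonal_mul_diagonal, ← Matrix.diagonal_one]
    congr 1
    funext i
    exact inv_mul_cancel₀ (by exact_mod_cast hm i)
  ext i
  rw [invApply, Matrix.diagonal_map (by simp)]
  simp [h, Matrix.mulVec_diagonal, div_eq_inv_mul]

/-- A unitary exponential matrix yields a tile containing the origin. -/
lemma IsAdmissiblePair.exists_isTile {m : Fin d → ℤ} (hm : ∀ i, m i ≠ 0)
    {B : Finset (Fin d → ℤ)} (hB : B.Nonempty) (h : IsAdmissiblePair (Matrix.diagonal m) B) :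
    ∃ L, 0 ∈ L ∧ IsTile (fun ξ => mask B (invScale m ξ)) L := by
  classical
  obtain ⟨-, L, -, hH, -⟩ := h
  set H := hadamardMatrix (Matrix.diagonal m) B L with hHdef
  have hN : (0 : ℝ) < B.card := by exact_mod_cast hB.card_pos
  have hsq : ((1 / Real.sqrt (B.card : ℝ) : ℝ) : ℂ) * ((1 / Real.sqrt (B.card : ℝ) : ℝ) : ℂ) =
      (B.card : ℂ)⁻¹ := by
    rw [← Complex.ofReal_mul, one_div, ← mul_inv, Real.mul_self_sqrt hN.le]
    simp
  have hent : ∀ b l, H b l = ((1 / Real.sqrt (B.card : ℝ) : ℝ) : ℂ) *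
      (starRingEnd ℂ) (expFun (invScale m (intVec l.1)) (intVec b.1)) := fun b l => by
    rw [hHdef, hadamardMatrix, Matrix.of_apply, invApply_diagonal hm, ← expFun_neg_left,
      ← expFun_comm, expFun]
    congr 2
    rw [inner_eq_sum, inner_eq_sum]
    push_cast
    rw [Finset.mul_sum, Finset.mul_sum]
    refine Finset.sum_congr rfl fun i _ => ?_
    simp
    ring
  have htile : IsTile (fun ξ => mask B (invScale m ξ)) L := by
    intro ξ
    -- The mask values at the translates of ξ are the conjugated entries of u H. Since H H* = 1,
    -- this row vector has the norm of u, which is 1.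
    let u : B → ℂ := fun b => ((1 / Real.sqrt (B.card : ℝ) : ℝ) : ℂ) *
      (starRingEnd ℂ) (expFun (invScale m ξ) (intVec b.1))
    have hmask : ∀ l : L, mask B (invScale m (ξ + intVec l.1)) =
        (starRingEnd ℂ) (Matrix.vecMul u H l) := by
      intro l
      simp only [Matrix.vecMul, dotProduct, hent, u, map_sum, map_mul, Complex.conj_conj,
        Complex.conj_ofReal]
      rw [mask, invScale_add, Finset.mul_sum, ← Finset.sum_coe_sort B]
      refine Finset.sum_congr rfl fun b _ => ?_
      rw [← hsq, expFun_add_left]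
      ring
    have hsum : Matrix.vecMul u H ⬝ᵥ star (Matrix.vecMul u H) = u ⬝ᵥ star u := by
      rw [Matrix.star_vecMul, Matrix.dotProduct_mulVec, Matrix.vecMul_vecMul, hH, Matrix.vecMul_one]
    have hsum1 : ∑ l : L, ‖Matrix.vecMul u H l‖ ^ 2 = ∑ b : B, ‖u b‖ ^ 2 := by
      have h1 : ∀ z : ℂ, z * star z = ((‖z‖ ^ 2 : ℝ) : ℂ) := fun z => by
        simpa using Complex.mul_conj' z
      simp only [dotProduct, Pi.star_apply, h1] at hsum
      exact_mod_cast hsum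
    rw [← Finset.sum_coe_sort L]
    simp only [hmask, RCLike.norm_conj]
    rw [hsum1]
    have : ∀ b, ‖u b‖ ^ 2 = (B.card : ℝ)⁻¹ := fun b => by
      simp [u]
    simp [this, hN.ne']
  have hne : L.Nonempty := by
    rw [Finset.nonempty_iff_ne_empty]
    rintro rfl
    simpa using htile 0
  obtain ⟨l₀, hl₀⟩ := hne
  -- The tile property is translation invariant, so one element may be moved to the origin.
  refine ⟨L.image fun l => l - l₀, Finset.mem_image.2 ⟨l₀, hl₀, sub_self _⟩,
    isTile_image (by simp [hB]) fun ξ => ?_⟩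
  rw [← htile (ξ - intVec l₀)]
  refine Finset.sum_congr rfl fun l _ => ?_
  rw [intVec_sub]
  congr 4
  abel

/-! ### Finite convolutions: transforms and supports. -/

lemma isProbabilityMeasure_discreteMeasure {A : Finset (EuclideanSpace ℝ (Fin d))}
    (hA : A.Nonempty) : IsProbabilityMeasure (discreteMeasure A) := by
  constructor
  have : (A.card : ℝ≥0∞) ≠ 0 := by simpa using hA.ne_empty
  simp [discreteMeasure, ENNReal.inv_mul_cancel this]

lemma ft_discreteMeasure (A : Finset (EuclideanSpace ℝ (Fin d)))
    (ξ : EuclideanSpace ℝ (Fin d)) :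
    ft (discreteMeasure A) ξ = (A.card : ℂ)⁻¹ * ∑ a ∈ A, expFun ξ a := by
  rw [ft, discreteMeasure, integral_smul_measure,
    integral_finsetSum_measure fun a _ => integrable_expFun _ ξ]
  simp

lemma invScale_injective {m : Fin d → ℤ} (hm : ∀ i, m i ≠ 0) :
    Function.Injective (invScale m) := by
  intro x y h
  ext i
  have h1 := congrArg (fun z : EuclideanSpace ℝ (Fin d) => z i) h
  have h2 : (m i : ℝ) ≠ 0 := by exact_mod_cast hm i
  simpa [h2, div_left_inj'] using h1

lemma invApply_injective {m : Fin d → ℤ} (hm : ∀ i, m i ≠ 0) :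
    Function.Injective (invApply (Matrix.diagonal m)) := by
  intro x y h
  rw [invApply_diagonal hm, invApply_diagonal hm] at h
  exact intVec_injective (invScale_injective hm h)

lemma expFun_invScale (m : Fin d → ℤ) (ξ x : EuclideanSpace ℝ (Fin d)) :
    expFun (invScale m ξ) x = expFun ξ (invScale m x) := expFun_scale _ _ _

lemma ft_discreteMeasure_invImage {m : Fin d → ℤ} (hm : ∀ i, m i ≠ 0) (B : Finset (Fin d → ℤ))
    (ξ : EuclideanSpace ℝ (Fin d)) :
    ft (discreteMeasure (invImage (Matrix.diagonal m) B)) ξ = mask B (invScale m ξ) := by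
  classical
  rw [ft_discreteMeasure, invImage, Finset.card_image_of_injective _ (invApply_injective hm),
    Finset.sum_image fun _ _ _ _ h => invApply_injective hm h, mask]
  simp_rw [invApply_diagonal hm, expFun_invScale]

lemma ft_conv (μ ν : Measure (EuclideanSpace ℝ (Fin d))) [IsFiniteMeasure μ] [IsFiniteMeasure ν]
    (ξ : EuclideanSpace ℝ (Fin d)) : ft (Measure.conv μ ν) ξ = ft μ ξ * ft ν ξ := by
  simp only [ft_eq_charFun, charFun_conv]

lemma matProd_diagonal (r : ℕ → Fin d → ℤ) (n : ℕ) :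
    matProd (fun n => Matrix.diagonal (r n)) n = Matrix.diagonal (diagProd r n) := by
  induction n with
  | zero => simp [matProd]
  | succ n ih =>
    rw [matProd, ih, Matrix.diagonal_mul_diagonal, diagProd_succ, mul_comm (diagProd r n)]
    rfl

lemma isProbabilityMeasure_finiteConvolution (R : ℕ → Matrix (Fin d) (Fin d) ℤ)
    {B : ℕ → Finset (Fin d → ℤ)} (hB : ∀ n, (B n).Nonempty) (n : ℕ) :
    IsProbabilityMeasure (finiteConvolution R B n) := by
  classical
  induction n with
  | zero => rw [finiteConvolution]; infer_instance
  | succ n ih =>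
    have := isProbabilityMeasure_discreteMeasure ((hB n).image (invApply (matProd R (n + 1))))
    rw [finiteConvolution, invImage]
    infer_instance

lemma ft_finiteConvolution {r : ℕ → Fin d → ℤ} (hr : ∀ n i, 2 ≤ r n i)
    {B : ℕ → Finset (Fin d → ℤ)} (hB : ∀ n, (B n).Nonempty) (n : ℕ)
    (ξ : EuclideanSpace ℝ (Fin d)) :
    ft (finiteConvolution (fun n => Matrix.diagonal (r n)) B n) ξ = maskProd r B n ξ := by
  classical
  induction n with
  | zero => rw [finiteConvolution]; simp [ft]
  | succ n ih =>
    have h1 := isProbabilityMeasure_discreteMeasure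
      ((hB n).image (invApply (matProd (fun n => Matrix.diagonal (r n)) (n + 1))))
    have h2 := isProbabilityMeasure_finiteConvolution (fun n => Matrix.diagonal (r n)) hB n
    rw [finiteConvolution, invImage, ft_conv, ih, maskProd_succ, invScale_invScale,
      ← diagProd_succ, ← ft_discreteMeasure_invImage fun i => (diagProd_pos hr (n + 1) i).ne',
      matProd_diagonal, invImage]

lemma ae_discreteMeasure {A : Finset (EuclideanSpace ℝ (Fin d))}
    {P : EuclideanSpace ℝ (Fin d) → Prop} (hP : ∀ a ∈ A, P a) :
    ∀ᵐ x ∂discreteMeasure A, P x := by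
  rw [ae_iff, discreteMeasure, Measure.smul_apply, Measure.finsetSum_apply]
  have : ∀ a ∈ A, Measure.dirac a {x | ¬P x} = 0 := fun a ha => by
    rw [← ae_iff, ae_dirac_eq]
    exact hP a ha
  rw [Finset.sum_eq_zero this, smul_zero]

lemma ae_conv {μ ν : Measure (EuclideanSpace ℝ (Fin d))}
    {P Q S : EuclideanSpace ℝ (Fin d) → Prop} (hS : MeasurableSet {x | S x})
    (hμ : ∀ᵐ x ∂μ, P x) (hν : ∀ᵐ x ∂ν, Q x) (h : ∀ x y, P x → Q y → S (x + y)) :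
    ∀ᵐ x ∂Measure.conv μ ν, S x := by
  rw [Measure.conv, ae_map_iff (by fun_prop) hS]
  filter_upwards [Measure.quasiMeasurePreserving_fst.ae hμ,
    Measure.quasiMeasurePreserving_snd.ae hν] with x h1 h2
  exact h _ _ h1 h2

/-- Every `b ∈ B` satisfies `0 ≤ b i ≤ m i - 1`. -/
def IsDigitSet (m : Fin d → ℤ) (B : Finset (Fin d → ℤ)) : Prop :=
  ∀ b ∈ B, ∀ i, 0 ≤ b i ∧ b i ≤ m i - 1

/-- The sharp bound makes the induction telescope: a digit of level n contributes at most (r_n -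
1)/P_{n+1} = 1/P_n - 1/P_{n+1} in each coordinate. -/
lemma ae_finiteConvolution {r : ℕ → Fin d → ℤ} (hr : ∀ n i, 2 ≤ r n i)
    {B : ℕ → Finset (Fin d → ℤ)} (hdig : ∀ n, IsDigitSet (r n) (B n)) (n : ℕ) :
    ∀ᵐ x ∂finiteConvolution (fun n => Matrix.diagonal (r n)) B n,
      ∀ i, 0 ≤ x i ∧ x i ≤ 1 - 1 / (diagProd r n i : ℝ) := by
  classical
  induction n with
  | zero => rw [finiteConvolution, ae_dirac_eq]; simp
  | succ n ih =>
    rw [finiteConvolution]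
    refine ae_conv (Q := fun x => ∀ i, 0 ≤ x i ∧ x i ≤ 1 / (diagProd r n i : ℝ) -
      1 / (diagProd r (n + 1) i : ℝ)) ?_ ih (ae_discreteMeasure fun a ha => ?_)
      fun x y hx hy i => ⟨add_nonneg (hx i).1 (hy i).1, ?_⟩
    · refine IsClosed.measurableSet ?_
      simp only [Set.ofPred_forall, Set.ofPred_and]
      refine isClosed_iInter fun i => (isClosed_le (by fun_prop) (by fun_prop)).inter
        (isClosed_le (by fun_prop) (by fun_prop))
    · rw [invImage, Finset.mem_image] at ha
      obtain ⟨b, hb, rfl⟩ := ha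
      intro i
      rw [matProd_diagonal, invApply_diagonal fun i => (diagProd_pos hr (n + 1) i).ne',
        invScale_apply, intVec_apply]
      have hp : (0 : ℝ) < diagProd r n i := by exact_mod_cast diagProd_pos hr n i
      have hri : (0 : ℝ) < r n i := by exact_mod_cast (by linarith [hr n i] : 0 < r n i)
      obtain ⟨h0, h1⟩ := hdig n b hb i
      have h0' : (0 : ℝ) ≤ b i := by exact_mod_cast h0
      have h1' : (b i : ℝ) ≤ r n i - 1 := by exact_mod_cast h1
      have : ((diagProd r (n + 1) i : ℤ) : ℝ) = diagProd r n i * r n i := by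
        rw [diagProd_succ]; simp
      rw [this]
      refine ⟨by positivity, ?_⟩
      have h2 : 1 / (diagProd r n i : ℝ) - 1 / (diagProd r n i * r n i) =
        (r n i - 1) / (diagProd r n i * r n i) := by field_simp
      rw [h2]
      gcongr
    · have h1 := (hx i).2
      have h2 := (hy i).2
      rw [PiLp.add_apply]
      linarith

lemma finiteConvolution_compl_cube {r : ℕ → Fin d → ℤ} (hr : ∀ n i, 2 ≤ r n i)
    {B : ℕ → Finset (Fin d → ℤ)} (hdig : ∀ n, IsDigitSet (r n) (B n)) (n : ℕ) :
    finiteConvolution (fun n => Matrix.diagonal (r n)) B n (cube d)ᶜ = 0 := by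
  have : ∀ᵐ x ∂finiteConvolution (fun n => Matrix.diagonal (r n)) B n, x ∈ cube d := by
    filter_upwards [ae_finiteConvolution hr hdig n] with x hx i
    have hp : (0 : ℝ) < diagProd r n i := by exact_mod_cast diagProd_pos hr n i
    exact ⟨(hx i).1, (hx i).2.trans (by linarith [one_div_pos.2 hp])⟩
  exact this

/-! ### Compactness of measures on the cube; existence of the infinite convolution. -/

/-- The probability measures carried by the unit cube. -/
def cubeMeasures (d : ℕ) : Set (ProbabilityMeasure (EuclideanSpace ℝ (Fin d))) :=
  {μ | (μ : Measure (EuclideanSpace ℝ (Fin d))) (cube d)ᶜ = 0}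

lemma isCompact_cubeMeasures : IsCompact (cubeMeasures d) := by
  have h := isCompact_setOfPred_probabilityMeasure_mass_eq_compl_isCompact_le
    (E := EuclideanSpace ℝ (Fin d)) (u := fun _ => 0) (K := fun _ => cube d) tendsto_const_nhds
    (fun _ => isCompact_cube) (Or.inl inferInstance)
  convert h using 1
  ext μ
  simp [cubeMeasures]

lemma continuous_ft_probabilityMeasure (ξ : EuclideanSpace ℝ (Fin d)) :
    Continuous fun μ : ProbabilityMeasure (EuclideanSpace ℝ (Fin d)) =>
      ft (μ : Measure (EuclideanSpace ℝ (Fin d))) ξ := by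
  rw [continuous_iff_continuousAt]
  intro μ
  exact (ProbabilityMeasure.tendsto_iff_forall_integral_rclike_tendsto ℂ).1 tendsto_id
    (BoundedContinuousFunction.ofNormedAddCommGroup (expFun ξ) (continuous_expFun ξ) 1
      (fun x => (norm_expFun ξ x).le))

lemma norm_mask_sub_one_le {B : Finset (Fin d → ℤ)} (hB : B.Nonempty)
    {ξ : EuclideanSpace ℝ (Fin d)} {c : ℝ} (hc : ∀ b ∈ B, |inner ℝ ξ (intVec b)| ≤ c) :
    ‖mask B ξ - 1‖ ≤ 2 * Real.pi * c := by
  have hN : (B.card : ℂ) ≠ 0 := by simpa using hB.ne_empty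
  have h1 : mask B ξ - 1 = (B.card : ℂ)⁻¹ * ∑ b ∈ B, (expFun ξ (intVec b) - 1) := by
    rw [mask, Finset.sum_sub_distrib, mul_sub]
    simp [hN]
  have h2 : ‖∑ b ∈ B, (expFun ξ (intVec b) - 1)‖ ≤ B.card * (2 * Real.pi * c) := by
    refine (norm_sum_le _ _).trans ?_
    rw [← nsmul_eq_mul]
    refine Finset.sum_le_card_nsmul _ _ _ fun b hb => ?_
    have := norm_expFun_sub_le ξ 0 (intVec b)
    rw [expFun_zero_left, sub_zero] at this
    exact this.trans (mul_le_mul_of_nonneg_left (hc b hb) Real.two_pi_pos.le)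
  have hN' : (0 : ℝ) < B.card := by exact_mod_cast hB.card_pos
  rw [h1, norm_mul, norm_inv, Complex.norm_natCast, inv_mul_le_iff₀ hN']
  exact h2

/-- Digits satisfy b_i ≤ r_i and P_n is at least 2^n in each coordinate, so the n-th factor differs
from 1 by O(2⁻ⁿ); the earlier factors have modulus at most 1. -/
lemma cauchySeq_maskProd {r : ℕ → Fin d → ℤ} (hr : ∀ n i, 2 ≤ r n i)
    {B : ℕ → Finset (Fin d → ℤ)} (hB : ∀ n, (B n).Nonempty)
    (hdig : ∀ n, IsDigitSet (r n) (B n)) (ξ : EuclideanSpace ℝ (Fin d)) :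
    CauchySeq fun n => maskProd r B n ξ := by
  refine cauchySeq_of_le_geometric (1 / 2) (2 * Real.pi * ∑ i, |ξ i|) (by norm_num) fun n => ?_
  rw [dist_comm, dist_eq_norm, maskProd_succ, ← mul_sub_one, norm_mul]
  refine (mul_le_of_le_one_left (norm_nonneg _) (norm_maskProd_le _ _ _ _)).trans ?_
  rw [mul_assoc]
  refine norm_mask_sub_one_le (hB n) fun b hb => ?_
  rw [inner_eq_sum, Finset.sum_mul]
  refine (Finset.abs_sum_le_sum_abs _ _).trans (Finset.sum_le_sum fun i _ => ?_)
  have hp : (0 : ℝ) < diagProd r n i := by exact_mod_cast diagProd_pos hr n i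
  have hp2 : (2 : ℝ) ^ n ≤ diagProd r n i := by exact_mod_cast two_pow_le_diagProd hr n i
  have hri : (0 : ℝ) < r n i := by exact_mod_cast (by linarith [hr n i] : 0 < r n i)
  obtain ⟨h0, h1⟩ := hdig n b hb i
  have h0' : (0 : ℝ) ≤ b i := by exact_mod_cast h0
  have h1' : (b i : ℝ) ≤ r n i := by exact_mod_cast h1.trans (by linarith)
  rw [invScale_apply, invScale_apply, intVec_apply, abs_mul, abs_div, abs_div, abs_of_pos hp,
    abs_of_pos hri, abs_of_nonneg h0', one_div, inv_pow]
  calc |ξ i| / diagProd r n i / r n i * b i = |ξ i| / diagProd r n i * (b i / r n i) := by ring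
    _ ≤ |ξ i| / 2 ^ n * 1 := by
        gcongr
        exact (div_le_one hri).2 h1'
    _ = |ξ i| * (2 ^ n)⁻¹ := by ring

/-- The infinite convolution exists and is carried by the unit cube. -/
theorem exists_tendsto_finiteConvolution {r : ℕ → Fin d → ℤ} (hr : ∀ n i, 2 ≤ r n i)
    {B : ℕ → Finset (Fin d → ℤ)} (hB : ∀ n, (B n).Nonempty)
    (hdig : ∀ n, IsDigitSet (r n) (B n)) :
    ∃ μ ∈ cubeMeasures d, IsInfiniteConvolution (fun n => Matrix.diagonal (r n)) B μ ∧
      ∀ ξ, Tendsto (fun n => maskProd r B n ξ) atTop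
        (𝓝 (ft (μ : Measure (EuclideanSpace ℝ (Fin d))) ξ)) := by
  let ν : ℕ → ProbabilityMeasure (EuclideanSpace ℝ (Fin d)) := fun n =>
    ⟨finiteConvolution (fun n => Matrix.diagonal (r n)) B n,
      isProbabilityMeasure_finiteConvolution _ hB n⟩
  have hν : ∀ n ξ, ft (ν n : Measure (EuclideanSpace ℝ (Fin d))) ξ = maskProd r B n ξ :=
    ft_finiteConvolution hr hB
  -- Compactness supplies a cluster point. The transforms converge, so their limit must be its
  -- transform, and convergence of characteristic functions then gives weak convergence of the whole
  -- sequence.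
  obtain ⟨μ, hμ, hcl⟩ := isCompact_cubeMeasures.exists_mapClusterPt (f := atTop) (u := ν) (by
    rw [le_principal_iff, mem_map]
    exact univ_mem' fun n => finiteConvolution_compl_cube hr hdig n)
  have hlim : ∀ ξ, Tendsto (fun n => maskProd r B n ξ) atTop
      (𝓝 (ft (μ : Measure (EuclideanSpace ℝ (Fin d))) ξ)) := by
    intro ξ
    obtain ⟨z, hz⟩ := cauchySeq_tendsto_of_complete (cauchySeq_maskProd hr hB hdig ξ)
    have h1 := hcl.tendsto_comp (continuous_ft_probabilityMeasure ξ).continuousAt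
    simp only [Function.comp_def, hν] at h1
    have : (𝓝 (ft (μ : Measure (EuclideanSpace ℝ (Fin d))) ξ) ⊓ 𝓝 z).NeBot :=
      h1.neBot.mono (inf_le_inf_left _ hz)
    rwa [eq_of_nhds_neBot this]
  refine ⟨μ, hμ, ⟨inferInstance, ?_⟩, hlim⟩
  have hconv : Tendsto ν atTop (𝓝 μ) := by
    refine ProbabilityMeasure.tendsto_of_tendsto_charFun fun t => ?_
    simp only [charFun_eq_ft, hν]
    exact hlim _
  exact ProbabilityMeasure.tendsto_iff_forall_integral_tendsto.1 hconv

lemma IsInfiniteConvolution.tendsto_ft {R : ℕ → Matrix (Fin d) (Fin d) ℤ}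
    {B : ℕ → Finset (Fin d → ℤ)} (hB : ∀ n, (B n).Nonempty)
    {μ : Measure (EuclideanSpace ℝ (Fin d))} (h : IsInfiniteConvolution R B μ)
    (ξ : EuclideanSpace ℝ (Fin d)) :
    Tendsto (fun n => ft (finiteConvolution R B n) ξ) atTop (𝓝 (ft μ ξ)) := by
  have hμ := h.1
  let ν : ℕ → ProbabilityMeasure (EuclideanSpace ℝ (Fin d)) := fun n =>
    ⟨finiteConvolution R B n, isProbabilityMeasure_finiteConvolution _ hB n⟩
  have h1 : Tendsto ν atTop (𝓝 ⟨μ, hμ⟩) :=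
    ProbabilityMeasure.tendsto_iff_forall_integral_tendsto.2 h.2
  exact ((continuous_ft_probabilityMeasure ξ).tendsto _).comp h1

/-! ### Vanishing on a coset of ℤ^d, seen on the torus. -/

/-- The projection of `ℝ^d` onto the torus. -/
def toTorus (x : EuclideanSpace ℝ (Fin d)) : UnitAddTorus (Fin d) := fun i => (x i : UnitAddCircle)

lemma continuous_toTorus : Continuous (toTorus (d := d)) :=
  continuous_pi fun i => (AddCircle.continuous_mk' 1).comp (by fun_prop)

lemma mFourier_toTorus (k : Fin d → ℤ) (x : EuclideanSpace ℝ (Fin d)) :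
    UnitAddTorus.mFourier k (toTorus x) = expFun (intVec k) x := by
  rw [UnitAddTorus.mFourier, ContinuousMap.coe_mk, expFun, inner_eq_sum]
  simp only [toTorus, fourier_coe_apply]
  rw [← Complex.exp_sum]
  push_cast
  rw [Finset.mul_sum]
  congr 1
  refine Finset.sum_congr rfl fun i _ => ?_
  simp
  ring

lemma exists_intVec_of_toTorus_eq {x y : EuclideanSpace ℝ (Fin d)} (h : toTorus x = toTorus y) :
    ∃ k, y = x + intVec k := by
  have h1 : ∀ i, ∃ k : ℤ, y i = x i + k := fun i => by
    have h2 : ((y i - x i : ℝ) : UnitAddCircle) = 0 := by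
      rw [AddCircle.coe_sub, sub_eq_zero]
      exact (congrFun h i).symm
    obtain ⟨n, hn⟩ := (AddCircle.coe_eq_zero_iff 1).1 h2
    exact ⟨n, by rw [zsmul_eq_mul, mul_one] at hn; linarith⟩
  choose k hk using h1
  exact ⟨k, by ext i; simp [hk]⟩

/-- The integral is a bounded functional of f that vanishes on the Fourier monomials by hypothesis,
and these span a dense subspace. -/
lemma integral_toTorus_mul_expFun_eq_zero {μ : Measure (EuclideanSpace ℝ (Fin d))}
    [IsFiniteMeasure μ] {ξ : EuclideanSpace ℝ (Fin d)} (hξ : ∀ k, ft μ (ξ + intVec k) = 0)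
    (f : C(UnitAddTorus (Fin d), ℂ)) : ∫ x, f (toTorus x) * expFun ξ x ∂μ = 0 := by
  have hint : ∀ f : C(UnitAddTorus (Fin d), ℂ),
      Integrable (fun x => f (toTorus x) * expFun ξ x) μ := fun f =>
    (integrable_const ‖f‖).mono ((f.continuous.comp continuous_toTorus).mul
      (continuous_expFun ξ)).aestronglyMeasurable (.of_forall fun x => by
        simpa using f.norm_coe_le_norm (toTorus x))
  let T : C(UnitAddTorus (Fin d), ℂ) →L[ℂ] ℂ := LinearMap.mkContinuous
    { toFun := fun f => ∫ x, f (toTorus x) * expFun ξ x ∂μ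
      map_add' := fun f g => by
        rw [← integral_add (hint f) (hint g)]
        simp [add_mul]
      map_smul' := fun c f => by
        simp [mul_assoc, integral_const_mul] } (μ.real Set.univ) (fun f => by
        rw [mul_comm]
        refine norm_integral_le_of_norm_le_const (.of_forall fun x => ?_)
        simpa using f.norm_coe_le_norm (toTorus x))
  have hker : (Submodule.span ℂ (Set.range UnitAddTorus.mFourier)).topologicalClosure ≤
      LinearMap.ker T.toLinearMap := by
    refine Submodule.topologicalClosure_minimal _ ?_ T.isClosed_ker
    rw [Submodule.span_le]
    rintro _ ⟨k, rfl⟩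
    rw [SetLike.mem_coe, LinearMap.mem_ker]
    change ∫ x, UnitAddTorus.mFourier k (toTorus x) * expFun ξ x ∂μ = 0
    rw [← hξ k, ft]
    simp_rw [mFourier_toTorus, expFun_add_left, mul_comm]
  rw [UnitAddTorus.span_mFourier_closure_eq_top] at hker
  exact hker (Submodule.mem_top (x := f))

/-- If the Fourier transform of `μ` vanishes on a coset of `ℤ^d`, then every point of the support
of `μ` has a different integer translate in every compact carrier of `μ`. -/
theorem exists_translate_mem_of_ft_eq_zero {μ : Measure (EuclideanSpace ℝ (Fin d))}
    [IsFiniteMeasure μ] {S : Set (EuclideanSpace ℝ (Fin d))} (hS : IsCompact S) (hμS : μ Sᶜ = 0)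
    {x₀ : EuclideanSpace ℝ (Fin d)} (hx₀ : ∀ U ∈ 𝓝 x₀, 0 < μ U)
    {ξ : EuclideanSpace ℝ (Fin d)} (hξ : ∀ k, ft μ (ξ + intVec k) = 0) :
    ∃ k ≠ 0, x₀ + intVec k ∈ S := by
  by_contra! hcon
  -- The phase is normalized to be 1 at x₀, so c is positive near x₀. A periodic cutoff that removes
  -- the part of S where c ≤ 0 but equals 1 at x₀ gives a nonnegative integrand with zero integral,
  -- against x₀ being in the support.
  let c : EuclideanSpace ℝ (Fin d) → ℝ := fun x =>
    ((starRingEnd ℂ) (expFun ξ x₀) * expFun ξ x).re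
  have hc : Continuous c := Complex.continuous_re.comp (continuous_const.mul (continuous_expFun ξ))
  have hc0 : c x₀ = 1 := by
    simp only [c, mul_comm ((starRingEnd ℂ) _), Complex.mul_conj', norm_expFun]
    simp
  let U : Set (EuclideanSpace ℝ (Fin d)) := {x | 0 < c x}
  have hU : IsOpen U := isOpen_lt continuous_const hc
  have hA : IsClosed (toTorus '' (S \ U)) := ((hS.diff hU).image continuous_toTorus).isClosed
  -- Such a cutoff exists because S contains no other integer translate of x₀ that could lie where c
  -- ≤ 0.
  have hx₀A : Disjoint (toTorus '' (S \ U)) {toTorus x₀} := by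
    rw [Set.disjoint_singleton_right]
    rintro ⟨y, ⟨hyS, hyU⟩, hy⟩
    obtain ⟨k, hk⟩ := exists_intVec_of_toTorus_eq hy.symm
    rcases eq_or_ne k 0 with rfl | hk0
    · rw [intVec_zero, add_zero] at hk
      exact hyU (by simp [U, hk, hc0])
    · exact hcon k hk0 (hk ▸ hyS)
  obtain ⟨f, hf0, hf1, hf⟩ := exists_continuous_zero_one_of_isClosed hA isClosed_singleton hx₀A
  let g : EuclideanSpace ℝ (Fin d) → ℝ := fun x => f (toTorus x) * c x
  have hgc : Continuous g := (f.continuous.comp continuous_toTorus).mul hc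
  have hg0 : 0 ≤ᵐ[μ] g := by
    have hs : ∀ᵐ x ∂μ, x ∈ S := hμS
    filter_upwards [hs] with x hx
    by_cases hxU : x ∈ U
    · exact mul_nonneg (hf _).1 (le_of_lt hxU)
    · have : f (toTorus x) = 0 := hf0 ⟨x, ⟨hx, hxU⟩, rfl⟩
      simp [g, this]
  have hcle : ∀ x, ‖c x‖ ≤ 1 := fun x => by
    refine (Complex.abs_re_le_norm _).trans ?_
    simp
  have hgi : Integrable g μ := (integrable_const (1 : ℝ)).mono hgc.aestronglyMeasurable
    (.of_forall fun x => by
      rw [norm_mul, norm_one, Real.norm_of_nonneg (hf _).1]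
      exact mul_le_one₀ (hf _).2 (norm_nonneg _) (hcle x))
  have hint : ∫ x, g x ∂μ = 0 := by
    have h1 := integral_toTorus_mul_expFun_eq_zero hξ
      ⟨fun t => (starRingEnd ℂ) (expFun ξ x₀) * (f t : ℂ), by fun_prop⟩
    have h2 := congrArg Complex.re h1
    rw [Complex.zero_re] at h2
    rw [← h2, ← RCLike.re_eq_complex_re, ← integral_re]
    · refine integral_congr_ae (.of_forall fun x => ?_)
      simp only [g, c, ContinuousMap.coe_mk, RCLike.re_eq_complex_re]
      rw [mul_right_comm, mul_comm _ (f _ : ℂ), Complex.re_ofReal_mul]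
    · refine (integrable_const (1 : ℝ)).mono ?_ (.of_forall fun x => ?_)
      · refine Continuous.aestronglyMeasurable (Continuous.mul ?_ (continuous_expFun ξ))
        exact continuous_const.mul (Complex.continuous_ofReal.comp
          (f.continuous.comp continuous_toTorus))
      · simpa [abs_of_nonneg (hf (toTorus x)).1] using (hf (toTorus x)).2
  rw [integral_eq_zero_iff_of_nonneg_ae hg0 hgi] at hint
  have hV : {x | 0 < g x} ∈ 𝓝 x₀ := (isOpen_lt continuous_const hgc).mem_nhds (by
    have : f (toTorus x₀) = 1 := hf1 rfl
    simp [g, this, hc0])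
  refine (hx₀ _ hV).ne' (measure_mono_null (fun x hx => ?_) (ae_iff.1 hint))
  exact (ne_of_gt hx : g x ≠ 0)

/-! ### Digit counters and points without integer translates. -/

/-- Counters that decrease by at most one per step, except for jumps from `0` to `r i - 1`, of
which there is at least one per step, cannot exist when all `r i` exceed the number of counters. -/
lemma false_of_counters {r : Fin d → ℤ} (hr : ∀ i, (d : ℤ) + 1 ≤ r i) (c : ℕ → Fin d → ℤ)
    (w : ℕ → Fin d → Prop) (hw : ∀ n, ∃ i, w n i)
    (hjump : ∀ n i, w n i → c n i = 0 ∧ c (n + 1) i = r i - 1)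
    (hstep : ∀ n i, ¬ w n i → c n i - 1 ≤ c (n + 1) i) : False := by
  choose i hi using hw
  -- Among the times 0, …, d two jumps use the same coordinate. At the later time t the counter is
  -- still at least r_i - 1 - (t - s - 1) ≥ 1, since t - s ≤ d, but a jump requires it to be 0.
  obtain ⟨s, t, hst, heq⟩ := Fintype.exists_ne_map_eq_of_card_lt
    (fun n : Fin (d + 1) => i n) (by simp)
  wlog hlt : s < t generalizing s t
  · exact this t s hst.symm heq.symm (lt_of_le_of_ne (not_lt.1 hlt) hst.symm)
  have key : ∀ j : ℕ, r (i s) - 1 - j ≤ c (s + 1 + j) (i s) := by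
    intro j
    induction j with
    | zero => simp [(hjump s (i s) (hi s)).2]
    | succ j ih =>
      by_cases hwj : w (s + 1 + j) (i s)
      · have := (hjump _ _ hwj).2
        rw [← add_assoc, this]
        push_cast
        linarith
      · have := hstep _ _ hwj
        rw [← add_assoc]
        push_cast
        linarith
  have hlt' : (s : ℕ) < t := hlt
  have ht := t.2
  have h1 := key (t - s - 1)
  have h2 : (s : ℕ) + 1 + (t - s - 1) = t := by omega
  rw [h2] at h1
  have h3 := (hjump t (i t) (hi t)).1
  rw [← heq] at h3
  have h4 := hr (i s)
  omega

/-- A self-similar first-level set in the unit cube contains a point without nontrivial integer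
translates in the set, if all scaling factors exceed the dimension. -/
lemma exists_no_translate {r : Fin d → ℤ} (hr : ∀ i, (d : ℤ) + 1 ≤ r i)
    {B : Finset (Fin d → ℤ)} (hB : B.Nonempty) (hdig : IsDigitSet r B)
    {S : Set (EuclideanSpace ℝ (Fin d))} (hS : S ⊆ cube d) {x : EuclideanSpace ℝ (Fin d)}
    (hx : x ∈ S) :
    ∃ b ∈ B, ∀ k ≠ 0, ∀ b' ∈ B, ∀ y ∈ S,
      invScale r (intVec b + x) + intVec k ≠ invScale r (intVec b' + y) := by
  by_contra! hcon
  -- Only the new digit b' is retained and y is discarded; keeping the same x at every step makes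
  -- this a self-map of B that can be iterated.
  have hstep : ∀ b : B, ∃ b' : B, ∃ k : Fin d → ℤ, k ≠ 0 ∧ ∃ y ∈ S,
      invScale r (intVec b.1 + x) + intVec k = invScale r (intVec b'.1 + y) := fun b => by
    obtain ⟨k, hk, b', hb', y, hy, h⟩ := hcon b.1 b.2
    exact ⟨⟨b', hb'⟩, k, hk, y, hy, h⟩
  choose next k hk y hy hnext using hstep
  have heq : ∀ b i, ((b.1 i : ℤ) : ℝ) + x i + r i * k b i = ((next b).1 i : ℤ) + y b i := by
    intro b i
    have h := congrArg (fun z : EuclideanSpace ℝ (Fin d) => z i) (hnext b)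
    have hri : (r i : ℝ) ≠ 0 := by
      have := hr i
      exact_mod_cast (by linarith : (0 : ℤ) < r i).ne'
    simp only [PiLp.add_apply, invScale_apply, intVec_apply] at h
    field_simp at h
    linarith
  obtain ⟨b₀, hb₀⟩ := hB
  let b : ℕ → B := fun n => next^[n] ⟨b₀, hb₀⟩
  have hb : ∀ n, b (n + 1) = next (b n) := fun n => Function.iterate_succ_apply' _ _ _
  classical
  refine false_of_counters hr
    -- Whether x_i = 1 fixes the direction of every jump in coordinate i: k_i > 0 forces x_i = 0 and
    -- the digit to go from 0 to r_i - 1, while k_i < 0 forces x_i = 1 and the reverse. Reflecting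
    -- the digit when x_i = 1 makes all jumps go upwards.
    (fun n i => if x i = 1 then r i - 1 - (b n).1 i else (b n).1 i)
    (fun n i => k (b n) i ≠ 0) (fun n => Function.ne_iff.1 (hk (b n))) ?_ ?_
  · intro n i hki
    simp only [hb]
    generalize b n = a at *
    have h := heq a i
    obtain ⟨hx0, hx1⟩ := hS hx i
    obtain ⟨hy0, hy1⟩ := hS (hy a) i
    obtain ⟨ha0, ha1⟩ := hdig _ a.2 i
    obtain ⟨hn0, hn1⟩ := hdig _ (next a).2 i
    have hri : 0 < r i := by linarith [hr i]
    -- A nonzero k_i shifts by at least r_i, the largest shift that digits in [0, r_i - 1] and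
    -- points of the cube allow, so every inequality is an equality.
    rcases lt_or_gt_of_ne hki with hneg | hpos
    · have hk1 : r i * k a i ≤ -r i := by nlinarith
      have hk1' : (r i : ℝ) * k a i ≤ -r i := by exact_mod_cast hk1
      have ha1' : (a.1 i : ℝ) ≤ r i - 1 := by exact_mod_cast ha1
      have hn0' : (0 : ℝ) ≤ (next a).1 i := by exact_mod_cast hn0
      have e1 : x i = 1 := by linarith
      have e2 : (a.1 i : ℝ) = r i - 1 := by linarith
      have e3 : ((next a).1 i : ℝ) = 0 := by linarith
      have e2' : a.1 i = r i - 1 := by exact_mod_cast e2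
      have e3' : (next a).1 i = 0 := by exact_mod_cast e3
      simp [e1, e2', e3']
    · have hk1 : r i ≤ r i * k a i := by nlinarith
      have hk1' : (r i : ℝ) ≤ r i * k a i := by exact_mod_cast hk1
      have ha0' : (0 : ℝ) ≤ a.1 i := by exact_mod_cast ha0
      have hn1' : ((next a).1 i : ℝ) ≤ r i - 1 := by exact_mod_cast hn1
      have e1 : x i = 0 := by linarith
      have e2 : (a.1 i : ℝ) = 0 := by linarith
      have e3 : ((next a).1 i : ℝ) = r i - 1 := by linarith
      have e2' : a.1 i = 0 := by exact_mod_cast e2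
      have e3' : (next a).1 i = r i - 1 := by exact_mod_cast e3
      simp [e1, e2', e3']
  · intro n i hki
    simp only [hb, not_not] at hki ⊢
    generalize b n = a at *
    have h := heq a i
    rw [hki] at h
    obtain ⟨hx0, hx1⟩ := hS hx i
    obtain ⟨hy0, hy1⟩ := hS (hy a) i
    split_ifs with hxi
    · have : ((next a).1 i : ℝ) ≤ a.1 i + 1 := by simp at h; linarith
      have : (next a).1 i ≤ a.1 i + 1 := by exact_mod_cast this
      linarith
    · have : (a.1 i : ℝ) - 1 ≤ (next a).1 i := by simp at h; linarith
      exact_mod_cast this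

/-! ### Nonvanishing on cosets and uniform lower bounds. -/

/-- The zero set of the Fourier transform of a self-similar first-level measure contains no
coset of `ℤ^d`, if all scaling factors exceed the dimension. -/
theorem exists_mask_mul_ft_ne_zero {r : Fin d → ℤ} (hr : ∀ i, (d : ℤ) + 1 ≤ r i)
    {B : Finset (Fin d → ℤ)} (hB : B.Nonempty) (hdig : IsDigitSet r B)
    {ν : Measure (EuclideanSpace ℝ (Fin d))} [IsProbabilityMeasure ν] (hν : ν (cube d)ᶜ = 0)
    (ξ : EuclideanSpace ℝ (Fin d)) :
    ∃ k, mask B (invScale r (ξ + intVec k)) * ft ν (invScale r (ξ + intVec k)) ≠ 0 := by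
  classical
  by_contra! hcon
  have hcont : ∀ b, Continuous fun x => invScale r (intVec b + x) := continuous_intVec_add _
  let S' := ν.support
  have hS' : S' ⊆ cube d := Measure.support_subset_of_isClosed isCompact_cube.isClosed hν
  have hS'c : IsCompact S' := isCompact_cube.of_isClosed_subset Measure.isClosed_support hS'
  have hS'0 : ν S'ᶜ = 0 := Measure.measure_compl_support
  obtain ⟨x, hx⟩ : S'.Nonempty := by
    rw [Set.nonempty_iff_ne_empty]
    intro h
    simp [h] at hS'0
  obtain ⟨b, hb, hno⟩ := exists_no_translate hr hB hdig hS' hx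
  -- The first-level measure, left unnormalized; the factor `B.card` in its transform is harmless
  -- for zeros.
  let μ : Measure (EuclideanSpace ℝ (Fin d)) :=
    ∑ b ∈ B, ν.map fun x => invScale r (intVec b + x)
  have hμfin : IsFiniteMeasure μ := by
    have : ∀ b, IsFiniteMeasure (ν.map fun x => invScale r (intVec b + x)) := fun b =>
      inferInstance
    infer_instance
  have hft : ∀ η, ft μ η = B.card * (mask B (invScale r η) * ft ν (invScale r η)) := by
    intro η
    have hN : (B.card : ℂ) ≠ 0 := by simpa using hB.ne_empty
    rw [ft, integral_finsetSum_measure fun b _ => integrable_expFun _ η, mask, ← mul_assoc,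
      ← mul_assoc, mul_inv_cancel₀ hN, one_mul, Finset.sum_mul]
    refine Finset.sum_congr rfl fun b _ => ?_
    rw [integral_map (hcont b).aemeasurable (continuous_expFun η).aestronglyMeasurable, ft,
      ← integral_const_mul]
    simp_rw [← expFun_invScale, expFun_add_right]
  have hSc : IsCompact (⋃ b ∈ B, (fun x => invScale r (intVec b + x)) '' S') :=
    B.isCompact_biUnion fun b _ => hS'c.image (hcont b)
  obtain ⟨k, hk0, hk⟩ := exists_translate_mem_of_ft_eq_zero (μ := μ) hSc (by
      rw [Measure.finsetSum_apply]
      refine Finset.sum_eq_zero fun b' hb' => ?_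
      rw [Measure.map_apply (hcont b').measurable hSc.isClosed.measurableSet.compl]
      refine measure_mono_null (t := S'ᶜ) ?_ hS'0
      intro y hy hyS
      exact hy (Set.mem_biUnion hb' ⟨y, hyS, rfl⟩))
    (x₀ := invScale r (intVec b + x)) (fun U hU => by
      have h1 : 0 < ν ((fun x => invScale r (intVec b + x)) ⁻¹' U) :=
        (Measure.mem_support_iff_forall x).1 hx _ ((hcont b).continuousAt.preimage_mem_nhds hU)
      rw [Measure.finsetSum_apply]
      exact (h1.trans_le (Measure.le_map_apply (hcont b).aemeasurable U)).trans_le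
        (Finset.single_le_sum (f := fun b => ν.map (fun x => invScale r (intVec b + x)) U)
          (fun _ _ => zero_le) hb))
    (ξ := ξ) (fun k => by rw [hft, hcon, mul_zero])
  simp only [Set.mem_iUnion, Set.mem_image] at hk
  obtain ⟨b', hb', y, hy, h⟩ := hk
  exact hno k hk0 b' hb' y hy h.symm

/-- A uniform version of the nonvanishing of Fourier transforms on cosets of `ℤ^d`. -/
theorem exists_le_norm_mask_mul_ft {r : Fin d → ℤ} (hr : ∀ i, (d : ℤ) + 1 ≤ r i)
    {B : Finset (Fin d → ℤ)} (hB : B.Nonempty) (hdig : IsDigitSet r B) :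
    ∃ ε > 0, ∀ ν ∈ cubeMeasures d, ∀ x, ∃ k, ε ≤ ‖mask B (invScale r (x + intVec k)) *
      ft (ν : Measure (EuclideanSpace ℝ (Fin d))) (invScale r (x + intVec k))‖ := by
  obtain ⟨C, hC0, hC⟩ := exists_norm_cube_le d
  let F : (Fin d → ℤ) → ProbabilityMeasure (EuclideanSpace ℝ (Fin d)) ×
      EuclideanSpace ℝ (Fin d) → ℝ := fun k q => ‖mask B (invScale r (q.2 + intVec k)) *
      ft (q.1 : Measure (EuclideanSpace ℝ (Fin d))) (invScale r (q.2 + intVec k))‖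
  have hft : ContinuousOn (fun q : ProbabilityMeasure (EuclideanSpace ℝ (Fin d)) ×
      EuclideanSpace ℝ (Fin d) => ft (q.1 : Measure (EuclideanSpace ℝ (Fin d))) q.2)
      (cubeMeasures d ×ˢ Set.univ) := by
    -- Weak continuity in ν and a Lipschitz bound in ξ uniform in ν together give joint continuity.
    refine continuousOn_prod_of_continuousOn_lipschitzOnWith' _ (2 * Real.pi * C).toNNReal
      (fun ν hν => ?_) fun ξ _ => (continuous_ft_probabilityMeasure ξ).continuousOn
    refine LipschitzOnWith.of_dist_le_mul fun x _ y _ => ?_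
    rw [Real.coe_toNNReal _ (by positivity), dist_eq_norm, dist_eq_norm]
    exact norm_ft_sub_le hC _ hν x y
  have hshift : ∀ k : Fin d → ℤ,
      Continuous fun x : EuclideanSpace ℝ (Fin d) => invScale r (x + intVec k) := fun k =>
    (continuous_scale _).comp (by fun_prop)
  have hF : ∀ k, ContinuousOn (F k) (cubeMeasures d ×ˢ cube d) := by
    intro k
    refine ContinuousOn.norm (ContinuousOn.mul ?_ ?_)
    · exact ((continuous_mask B).comp ((hshift k).comp continuous_snd)).continuousOn
    · exact hft.comp (continuous_fst.prodMk ((hshift k).comp continuous_snd)).continuousOn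
        fun q hq => ⟨hq.1, Set.mem_univ _⟩
  have key : ∃ ε > 0, ∀ q ∈ cubeMeasures d ×ˢ cube d, ∃ k, ε ≤ F k q := by
    -- Near each (ν, x) a single k works with half the value there; finitely many such
    -- neighbourhoods suffice.
    refine (isCompact_cubeMeasures.prod isCompact_cube).induction_on
      (p := fun s => ∃ ε > 0, ∀ q ∈ s, ∃ k, ε ≤ F k q) ⟨1, one_pos, by simp⟩ ?_ ?_ ?_
    · rintro s t hst ⟨ε, hε, h⟩
      exact ⟨ε, hε, fun q hq => h q (hst hq)⟩
    · rintro s t ⟨ε, hε, h⟩ ⟨ε', hε', h'⟩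
      refine ⟨min ε ε', lt_min hε hε', fun q hq => ?_⟩
      rcases hq with hq | hq
      · obtain ⟨k, hk⟩ := h q hq
        exact ⟨k, (min_le_left _ _).trans hk⟩
      · obtain ⟨k, hk⟩ := h' q hq
        exact ⟨k, (min_le_right _ _).trans hk⟩
    · intro q hq
      obtain ⟨k, hk⟩ := exists_mask_mul_ft_ne_zero hr hB hdig
        (ν := (q.1 : Measure (EuclideanSpace ℝ (Fin d)))) hq.1 q.2
      have hpos : 0 < F k q := norm_pos_iff.2 hk
      have hev := (hF k q hq).eventually_const_lt (half_lt_self hpos)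
      exact ⟨_, hev, F k q / 2, half_pos hpos, fun q' hq' => ⟨k, le_of_lt hq'⟩⟩
  obtain ⟨ε, hε, h⟩ := key
  refine ⟨ε, hε, fun ν hν x => ?_⟩
  -- Only the class of x modulo ℤ^d matters, so x is reduced to the cube and k is corrected by its
  -- integer part.
  let n : Fin d → ℤ := fun i => ⌊x i⌋
  obtain ⟨k, hk⟩ := h (ν, x - intVec n) ⟨hν, fun i => by
    exact ⟨Int.fract_nonneg (x i), (Int.fract_lt_one (x i)).le⟩⟩
  refine ⟨k - n, ?_⟩
  have : x + intVec (k - n) = x - intVec n + intVec k := by rw [intVec_sub]; abel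
  rw [this]
  exact hk

lemma isEquiPositive_ft {φ : ℕ → ProbabilityMeasure (EuclideanSpace ℝ (Fin d))}
    (hφ : ∀ n, φ n ∈ cubeMeasures d) {G : Set ℕ} {ε : ℝ} (hε : 0 < ε)
    (h : ∀ n ∈ G, ∀ x, ∃ k : Fin d → ℤ,
      ε ≤ ‖ft (φ n : Measure (EuclideanSpace ℝ (Fin d))) (x + intVec k)‖) :
    ∃ ε' > 0, ∃ δ > 0,
      IsEquiPositive (fun n => ft (φ n : Measure (EuclideanSpace ℝ (Fin d)))) G ε' δ := by
  obtain ⟨C, hC0, hC⟩ := exists_norm_cube_le d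
  have hM : 0 < 2 * Real.pi * C := by positivity
  refine ⟨ε / 2, by positivity, ε / 2 / (2 * Real.pi * C), by positivity, fun n hn => ?_⟩
  have hlip : ∀ x y, ‖y‖ < ε / 2 / (2 * Real.pi * C) →
      ‖ft (φ n : Measure (EuclideanSpace ℝ (Fin d))) x‖ - ε / 2 ≤
        ‖ft (φ n : Measure (EuclideanSpace ℝ (Fin d))) (x + y)‖ := by
    intro x y hy
    have h1 := norm_ft_sub_le hC (φ n : Measure (EuclideanSpace ℝ (Fin d))) (hφ n) x (x + y)
    have h2 := norm_sub_norm_le (ft (φ n : Measure (EuclideanSpace ℝ (Fin d))) x)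
      (ft (φ n : Measure (EuclideanSpace ℝ (Fin d))) (x + y))
    rw [sub_add_cancel_left, norm_neg] at h1
    have h3 := (lt_div_iff₀ hM).1 hy
    linarith
  obtain ⟨k₀, hk₀⟩ := h n hn 0
  -- This lets ε / 2 also serve near the origin, where the transform starts from the value 1.
  have hε1 : ε ≤ 1 := hk₀.trans (norm_ft_le _ _)
  refine ⟨fun y hy => ?_, fun x => ?_⟩
  · have := hlip 0 y hy
    rw [ft_zero, norm_one, zero_add] at this
    linarith
  · obtain ⟨k, hk⟩ := h n hn x
    exact ⟨k, fun y hy => by linarith [hlip (x + intVec k) y hy]⟩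

/-! ### Tails of the infinite convolution and conclusion. -/

/-- Spectrality of infinite convolutions of diagonal admissible pairs. -/
theorem exists_isSpectrum_of_diagonal {r : ℕ → Fin d → ℤ} (hr : ∀ n i, 2 ≤ r n i)
    {B : ℕ → Finset (Fin d → ℤ)} (hB : ∀ n, (B n).Nonempty)
    (hdig : ∀ n, IsDigitSet (r n) (B n))
    (hadm : ∀ n, IsAdmissiblePair (Matrix.diagonal (r n)) (B n))
    {r₀ : Fin d → ℤ} {B₀ : Finset (Fin d → ℤ)} (hr₀ : ∀ i, (d : ℤ) + 1 ≤ r₀ i)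
    (hinf : {n | r n = r₀ ∧ B n = B₀}.Infinite)
    {μ : Measure (EuclideanSpace ℝ (Fin d))}
    (hμ : IsInfiniteConvolution (fun n => Matrix.diagonal (r n)) B μ) :
    ∃ Λ ⊆ intLattice d, IsSpectrum μ Λ := by
  have := hμ.1
  have htail : ∀ n, ∃ ν ∈ cubeMeasures d, ∀ ξ,
      Tendsto (fun k => maskProd (fun j => r (n + j)) (fun j => B (n + j)) k ξ) atTop
        (𝓝 (ft (ν : Measure (EuclideanSpace ℝ (Fin d))) ξ)) := fun n => by
    obtain ⟨ν, h1, -, h2⟩ := exists_tendsto_finiteConvolution (r := fun j => r (n + j))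
      (B := fun j => B (n + j)) (fun _ => hr _) (fun _ => hB _) (fun _ => hdig _)
    exact ⟨ν, h1, h2⟩
  choose ν hν hlim using htail
  have hft : ∀ ξ, Tendsto (fun n => maskProd r B n ξ) atTop (𝓝 (ft μ ξ)) := fun ξ => by
    simpa only [ft_finiteConvolution hr hB] using hμ.tendsto_ft hB ξ
  have hsplit : ∀ n ξ, ft μ ξ = maskProd r B n ξ *
      ft (ν n : Measure (EuclideanSpace ℝ (Fin d))) (invScale (diagProd r n) ξ) := by
    intro n ξ
    have h1 : Tendsto (fun k => maskProd r B (n + k) ξ) atTop (𝓝 (ft μ ξ)) :=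
      (hft ξ).comp (tendsto_atTop_mono (fun k => Nat.le_add_left k n) tendsto_id)
    simp_rw [maskProd_add] at h1
    exact tendsto_nhds_unique h1 ((hlim n _).const_mul _)
  -- Peeling one level off the tail: at an index where the repeated pair occurs, this is the product
  -- bounded below by `exists_le_norm_mask_mul_ft`, uniformly in the next tail.
  have hstep : ∀ n ξ, ft (ν n : Measure (EuclideanSpace ℝ (Fin d))) ξ =
      mask (B n) (invScale (r n) ξ) *
        ft (ν (n + 1) : Measure (EuclideanSpace ℝ (Fin d))) (invScale (r n) ξ) := by
    intro n ξ
    have h1 := (hlim n ξ).comp 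
      (tendsto_atTop_mono (fun k => Nat.le_add_left k 1) tendsto_id)
    simp only [Function.comp_def, maskProd_add, ← add_assoc] at h1
    have h2 : diagProd (fun j => r (n + j)) 1 = r n := by simp [diagProd]
    have h3 : maskProd (fun j => r (n + j)) (fun j => B (n + j)) 1 ξ =
        mask (B n) (invScale (r n) ξ) := by simp [maskProd, diagProd]
    rw [h2, h3] at h1
    exact tendsto_nhds_unique h1 ((hlim (n + 1) _).const_mul _)
  obtain ⟨n₀, hn₀, hn₀'⟩ := hinf.nonempty
  have hB₀ : B₀.Nonempty := by rw [← hn₀']; exact hB n₀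
  have hdig₀ : IsDigitSet r₀ B₀ := by rw [← hn₀, ← hn₀']; exact hdig n₀
  have hr0 : ∀ n i, r n i ≠ 0 := fun n i => (lt_of_lt_of_le two_pos (hr n i)).ne'
  obtain ⟨ε, hε, hlow⟩ := exists_le_norm_mask_mul_ft hr₀ hB₀ hdig₀
  obtain ⟨ε', hε', δ, hδ, hequi⟩ := isEquiPositive_ft hν (G := {n | r n = r₀ ∧ B n = B₀}) hε
    fun n hn x => by
      obtain ⟨k, hk⟩ := hlow (ν (n + 1)) (hν _) x
      exact ⟨k, by rwa [hstep, hn.1, hn.2]⟩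
  have hφ1 : ∀ n ξ, ‖ft (ν n : Measure (EuclideanSpace ℝ (Fin d))) ξ‖ ≤ 1 := fun n ξ =>
    norm_ft_le _ _
  have hL : ∀ n, ∃ L, 0 ∈ L ∧ IsTile (fun ξ => mask (B n) (invScale (r n) ξ)) L := fun n =>
    (hadm n).exists_isTile (hr0 n) (hB n)
  obtain ⟨Λ, horth, hsum⟩ := exists_orthogonal_hasSum (Φ := ft μ)
    (φ := fun n => ft (ν n : Measure (EuclideanSpace ℝ (Fin d)))) hr hB hL hφ1 hsplit hft hinf
    hε' hδ hequi
  refine ⟨intVec '' Λ, Set.image_subset_range _ _,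
    isSpectrum_of_hasSum (Λ.to_countable.image _) ?_ fun ξ => ?_⟩
  · rintro _ ⟨a, ha, rfl⟩ _ ⟨b, hb, rfl⟩ hab
    exact horth a ha b hb fun h => hab (h ▸ rfl)
  · exact ((Equiv.Set.image _ Λ intVec_injective).hasSum_iff
      (f := fun a : intVec '' Λ => ‖ft μ (ξ + a)‖ ^ 2)).1 (hsum ξ)

end InfConv

end

theorem theorem1p5 (d : ℕ)
    (R : ℕ → Matrix (Fin d) (Fin d) ℤ) (B : ℕ → Finset (Fin d → ℤ))
    (hD : ∀ n, (R n, B n) ∈ InfConv.diagonalPairs d)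
    (hadm : ∀ n, InfConv.IsAdmissiblePair (R n) (B n))
    (hinf : ∃ (R₀ : Matrix (Fin d) (Fin d) ℤ) (B₀ : Finset (Fin d → ℤ)),
      InfConv.IsAdmissiblePair R₀ B₀ ∧
      {n : ℕ | R n = R₀ ∧ B n = B₀}.Infinite ∧
      ∀ i, (d : ℤ) + 1 ≤ R₀ i i) :
    (∃ μ : Measure (EuclideanSpace ℝ (Fin d)), InfConv.IsInfiniteConvolution R B μ) ∧
      ∀ μ : Measure (EuclideanSpace ℝ (Fin d)), InfConv.IsInfiniteConvolution R B μ →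
        ∃ Λ : Set (EuclideanSpace ℝ (Fin d)),
          Λ ⊆ InfConv.intLattice d ∧ InfConv.IsSpectrum μ Λ := by
  obtain ⟨R₀, B₀, -, hinf, hR₀⟩ := hinf
  obtain ⟨r, rfl⟩ : ∃ r : ℕ → Fin d → ℤ, R = fun n => Matrix.diagonal (r n) :=
    ⟨fun n => (R n).diag,
      funext fun n => ((Matrix.isDiag_iff_diagonal_diag _).1 (hD n).1).symm⟩
  have hr : ∀ n i, 2 ≤ r n i := fun n i => by simpa using (hD n).2.1 i
  have hB : ∀ n, (B n).Nonempty := fun n => (hD n).2.2.1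
  have hdig : ∀ n, InfConv.IsDigitSet (r n) (B n) := fun n b hb i => by
    simpa using (hD n).2.2.2 b hb i
  refine ⟨?_, fun μ hμ => ?_⟩
  · obtain ⟨μ, -, hμ, -⟩ := InfConv.exists_tendsto_finiteConvolution hr hB hdig
    exact ⟨μ, hμ⟩
  · refine InfConv.exists_isSpectrum_of_diagonal hr hB hdig hadm (r₀ := R₀.diag) (B₀ := B₀) hR₀
      (hinf.mono ?_) hμ
    rintro n ⟨h1, h2⟩
    exact ⟨by rw [← h1, Matrix.diag_diagonal], h2⟩
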